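/- Let $d\in\mathbb N$ and let $\omega:[0,\infty)\to[0,\infty)$ be a non-quasianalytic subadditive weight function, i.e. a continuous increasing (meaning non-decreasing) function such that $(\alpha)$ $\omega(t_1+t_2)\le\omega(t_1)+\omega(t_2)$ for all $t_1,t_2\ge0$; $(\beta)$ $\int_1^{\infty}\omega(t)t^{-2}\,dt<\infty$; $(\gamma)$ $\log t=o(\omega(t))$ as $t\to\infty$; $(\delta)$ $t\mapsto\omega(e^t)$ is convex on $\mathbb R$. Put $\omega(z):=\omega(|z|)$ for a vector $z$. Let $\mathcal S_\omega=\mathcal S_\omega(\mathbb R^d)$ be the space of all Schwartz functions $f\in\mathcal S(\mathbb R^d)$ such that for all $\lambda>0$ and all multi-indices $\alpha$ $$\sup_{x}e^{\lambda\omega(x)}|D^\alpha f(x)|<\infty,\qquad \sup_{\xi}e^{\lambda\omega(\xi)}|D^\alpha\hat f(\xi)|<\infty,\qquad \hat f(\xi)=\int_{\mathbb R^d}e^{-i\langle x,\xi\rangle}f(x)\,dx,$$ with the locally convex topology defined by these seminorms, and let $\mathcal S'_\omega$ be the space of continuous linear functionals on $\mathcal S_\omega$. Let $\langle u,\varphi\rangle:=u(\overline\varphi)$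 for $u\in\mathcal S'_\omega$, $\varphi\in\mathcal S_\omega$. For $z=(x,\xi)\in\mathbb R^{2d}$ let $\Pi(z)=M_\xi T_x$, where $T_xf(t)=f(t-x)$ and $M_\xi f(t)=e^{i\langle t,\xi\rangle}f(t)$ on $\mathcal S_\omega$, and where these operators act on $u\in\mathcal S'_\omega$ by duality: $(T_xu)(f)=u(T_{-x}f)$ and $(M_\xi u)(f)=u(M_\xi f)$. For a window $\varphi\in\mathcal S_\omega\setminus\{0\}$ and $u\in\mathcal S'_\omega$ let $V_\varphi u(z)=\langle u,\Pi(z)\varphi\rangle$. The $\omega$-wave front set $\mathrm{WF}'_\omega(u)$, computed with the window $\varphi$, is the set of all $z_0\in\mathbb R^{2d}\setminus\{0\}$ for which there is no open conic set $\Gamma\subseteq\mathbb R^{2d}\setminus\{0\}$ containing $z_0$ with $$\sup_{z\in\Gamma}e^{\lambda\omega(z)}|V_\varphi u(z)|<\infty\qquad\text{for all }\lambda>0 .$$ Then for every $w\in\mathbb R^{2d}$ and every $u\in\mathcal S'_\omega$, $$\mathrm{WF}'_\omega(\Pi(w)u)=\mathrm{WF}'_\omega(u),$$ where the two wave front sets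 may be computed with any two windows $\varphi,\psi\in\mathcal S_\omega\setminus\{0\}$. -/

import Mathlib

open scoped SchwartzMap FourierTransform ComplexConjugate

noncomputable section

namespace GaborWF

/-- The Euclidean space `ℝ^d`. -/
abbrev Euc (d : ℕ) : Type := EuclideanSpace ℝ (Fin d)

/-- The phase space `ℝ^{2d}`, whose points are the pairs `z = (x, ξ)`, with the Euclidean norm
`|z|² = |x|² + |ξ|²`. -/
abbrev PhaseSpace (d : ℕ) : Type := WithLp 2 (Euc d × Euc d)

/-- A non-quasianalytic subadditive weight function `ω : [0, ∞) → [0, ∞)`. It is represented by a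
function on `ℝ`, of which only the values on `[0, ∞)` are ever used. -/
structure Weight where
  toFun : ℝ → ℝ
  nonneg : ∀ t, 0 ≤ t → 0 ≤ toFun t
  continuousOn : ContinuousOn toFun (Set.Ici 0)
  monotoneOn : MonotoneOn toFun (Set.Ici 0)
  subadditive : ∀ s t, 0 ≤ s → 0 ≤ t → toFun (s + t) ≤ toFun s + toFun t
  integrable : MeasureTheory.IntegrableOn (fun t : ℝ => toFun t / t ^ 2) (Set.Ioi 1)
  log_isLittleO : Real.log =o[Filter.atTop] toFun
  convex : ConvexOn ℝ Set.univ (fun t : ℝ => toFun (Real.exp t))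

instance : CoeFun Weight (fun _ => ℝ → ℝ) := ⟨Weight.toFun⟩

/-- The Fourier transform `∫ e^{-i⟨x,ξ⟩} f(x) dx`. -/
def fourierHat {d : ℕ} (f : Euc d → ℂ) (ξ : Euc d) : ℂ :=
  ∫ x, Complex.exp (-(Complex.I * ((inner ℝ x ξ : ℝ) : ℂ))) * f x

/-- The quantity `e^{μ ω(x)} |∂^n g(x)|`, where `|∂^n g(x)|` is the operator norm of the `n`-th
derivative of `g` at `x`. It is comparable, with constants depending on `n` and `d` only, with the
maximum of `e^{μ ω(x)} |D^α g(x)|` over the multi-indices `α` with `|α| = n`. -/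
def wnorm {d : ℕ} (ω : Weight) (μ : ℝ) (n : ℕ) (g : Euc d → ℂ) (x : Euc d) : ℝ :=
  Real.exp (μ * ω ‖x‖) * ‖iteratedFDeriv ℝ n g x‖

/-- `sup_x e^{μ ω(x)} |D^α g(x)| < ∞` for all `μ > 0` and all multi-indices `α`. -/
def RapidDecay {d : ℕ} (ω : Weight) (g : Euc d → ℂ) : Prop :=
  ∀ μ : ℝ, 0 < μ → ∀ n : ℕ, BddAbove (Set.range (wnorm ω μ n g))

/-- `sup_x e^{μ ω(x)} |∂^n g(x)|`. -/
def wsup {d : ℕ} (ω : Weight) (μ : ℝ) (n : ℕ) (g : Euc d → ℂ) : ℝ :=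
  ⨆ x, wnorm ω μ n g x

/-- The character `e^{i⟨x,η⟩}`. -/
def character {d : ℕ} (η : Euc d) (x : Euc d) : ℂ :=
  Complex.exp (Complex.I * ((inner ℝ x η : ℝ) : ℂ))

section Estimates

variable {d : ℕ} {ω : Weight}

theorem wnorm_nonneg (ω : Weight) (μ : ℝ) (n : ℕ) (g : Euc d → ℂ) (x : Euc d) :
    0 ≤ wnorm ω μ n g x := by
  unfold wnorm; positivity

theorem wsup_nonneg (ω : Weight) (μ : ℝ) (n : ℕ) (g : Euc d → ℂ) : 0 ≤ wsup ω μ n g :=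
  Real.iSup_nonneg (wnorm_nonneg ω μ n g)

theorem RapidDecay.le_wsup {g : Euc d → ℂ} (hg : RapidDecay ω g) {μ : ℝ} (hμ : 0 < μ) (n : ℕ)
    (x : Euc d) : wnorm ω μ n g x ≤ wsup ω μ n g :=
  le_ciSup (hg μ hμ n) x

theorem bdd_of_le {g : Euc d → ℂ} {μ : ℝ} {n : ℕ} {C : ℝ} (h : ∀ x, wnorm ω μ n g x ≤ C) :
    BddAbove (Set.range (wnorm ω μ n g)) :=
  ⟨C, by rintro _ ⟨x, rfl⟩; exact h x⟩

theorem wsup_le {g : Euc d → ℂ} {μ : ℝ} {n : ℕ} {C : ℝ} (h : ∀ x, wnorm ω μ n g x ≤ C) :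
    wsup ω μ n g ≤ C :=
  ciSup_le h

theorem contDiff_nat {g : Euc d → ℂ} (hg : ContDiff ℝ (⊤ : ℕ∞) g) (n : ℕ) : ContDiff ℝ n g :=
  hg.of_le (by exact_mod_cast le_top)

theorem wnorm_add_le {f g : Euc d → ℂ} (hf : ContDiff ℝ (⊤ : ℕ∞) f)
    (hg : ContDiff ℝ (⊤ : ℕ∞) g) (μ : ℝ) (n : ℕ) (x : Euc d) :
    wnorm ω μ n (f + g) x ≤ wnorm ω μ n f x + wnorm ω μ n g x := by
  unfold wnorm
  rw [iteratedFDeriv_add_apply (contDiff_nat hf n).contDiffAt (contDiff_nat hg n).contDiffAt,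
    ← mul_add]
  gcongr
  exact norm_add_le _ _

theorem wnorm_smul {f : Euc d → ℂ} (hf : ContDiff ℝ (⊤ : ℕ∞) f) (c : ℂ) (μ : ℝ) (n : ℕ)
    (x : Euc d) : wnorm ω μ n (c • f) x = ‖c‖ * wnorm ω μ n f x := by
  unfold wnorm
  rw [iteratedFDeriv_const_smul_apply (contDiff_nat hf n).contDiffAt, norm_smul]
  ring

theorem wsup_smul {f : Euc d → ℂ} (hf : ContDiff ℝ (⊤ : ℕ∞) f) (c : ℂ) (μ : ℝ) (n : ℕ) :
    wsup ω μ n (c • f) = ‖c‖ * wsup ω μ n f := by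
  unfold wsup
  rw [Real.mul_iSup_of_nonneg (norm_nonneg c)]
  exact iSup_congr fun x => wnorm_smul hf c μ n x

theorem weight_norm_le (ω : Weight) (x y : Euc d) : ω ‖x‖ ≤ ω ‖y‖ + ω ‖x - y‖ := by
  have h : ‖x‖ ≤ ‖y‖ + ‖x - y‖ := by
    have := norm_add_le y (x - y)
    simpa using this
  exact (ω.monotoneOn (norm_nonneg _) (by simp only [Set.mem_Ici]; positivity) h).trans
    (ω.subadditive _ _ (norm_nonneg _) (norm_nonneg _))

theorem wnorm_translate_le {μ : ℝ} (hμ : 0 < μ) (n : ℕ) (g : Euc d → ℂ) (y x : Euc d) :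
    wnorm ω μ n (fun t => g (t - y)) x ≤ Real.exp (μ * ω ‖y‖) * wnorm ω μ n g (x - y) := by
  unfold wnorm
  rw [iteratedFDeriv_comp_sub, ← mul_assoc, ← Real.exp_add, ← mul_add]
  gcongr
  exact weight_norm_le ω x y

theorem contDiff_character (η : Euc d) : ContDiff ℝ (⊤ : ℕ∞) (character η) := by
  unfold character
  exact (contDiff_const.mul (Complex.ofRealCLM.contDiff.comp
    (contDiff_id.inner ℝ contDiff_const))).cexp

theorem norm_character (η x : Euc d) : ‖character η x‖ = 1 := by
  unfold character
  rw [mul_comm]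
  exact Complex.norm_exp_ofReal_mul_I _

theorem iteratedDeriv_expI (n : ℕ) :
    iteratedDeriv n (fun t : ℝ => Complex.exp (Complex.I * (t : ℂ))) =
      fun t : ℝ => Complex.I ^ n * Complex.exp (Complex.I * (t : ℂ)) := by
  induction n with
  | zero => simp
  | succ n ih =>
    rw [iteratedDeriv_succ, ih]
    funext t
    have h : HasDerivAt (fun t : ℝ => Complex.I * (t : ℂ)) (Complex.I * 1) t :=
      (Complex.ofRealCLM.hasDerivAt (x := t)).const_mul Complex.I
    have h2 := (h.cexp.const_mul (Complex.I ^ n)).deriv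
    rw [h2]
    ring

theorem norm_iteratedFDeriv_character_le (η : Euc d) (n : ℕ) (x : Euc d) :
    ‖iteratedFDeriv ℝ n (character η) x‖ ≤ ‖η‖ ^ n := by
  have hfun : character η =
      (fun t : ℝ => Complex.exp (Complex.I * (t : ℂ))) ∘ (innerSL ℝ η) := by
    funext t
    simp [character, real_inner_comm]
  have hsm : ContDiff ℝ n (fun t : ℝ => Complex.exp (Complex.I * (t : ℂ))) :=
    (contDiff_const.mul Complex.ofRealCLM.contDiff).cexp
  rw [hfun, ContinuousLinearMap.iteratedFDeriv_comp_right _ hsm _ le_rfl]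
  refine (ContinuousMultilinearMap.norm_compContinuousLinearMap_le _ _).trans ?_
  rw [norm_iteratedFDeriv_eq_norm_iteratedDeriv, iteratedDeriv_expI]
  rw [norm_mul, norm_pow, Complex.norm_I, one_pow, one_mul, mul_comm Complex.I,
    Complex.norm_exp_ofReal_mul_I, one_mul]
  simp

theorem wnorm_modulate_le {g : Euc d → ℂ} (hg : ContDiff ℝ (⊤ : ℕ∞) g) (μ : ℝ) (n : ℕ)
    (η x : Euc d) :
    wnorm ω μ n (fun t => character η t * g t) x ≤
      ∑ k ∈ Finset.range (n + 1), ((n.choose k : ℝ) * ‖η‖ ^ k) * wnorm ω μ (n - k) g x := by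
  unfold wnorm
  refine (mul_le_mul_of_nonneg_left (norm_iteratedFDeriv_mul_le (contDiff_character η) hg x
    (by exact_mod_cast le_top)) (Real.exp_nonneg _)).trans ?_
  rw [Finset.mul_sum]
  refine Finset.sum_le_sum fun k _ => ?_
  have := norm_iteratedFDeriv_character_le η k x
  calc _ = (n.choose k : ℝ) * ‖iteratedFDeriv ℝ k (character η) x‖ *
        (Real.exp (μ * ω ‖x‖) * ‖iteratedFDeriv ℝ (n - k) g x‖) := by ring
    _ ≤ _ := by gcongr

theorem wnorm_conj (g : Euc d → ℂ) (μ : ℝ) (n : ℕ) (x : Euc d) :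
    wnorm ω μ n (fun t => conj (g t)) x = wnorm ω μ n g x := by
  unfold wnorm
  rw [← LinearIsometryEquiv.norm_iteratedFDeriv_comp_left (𝕜 := ℝ) Complex.conjLIE g x n]
  rfl

theorem wnorm_neg (g : Euc d → ℂ) (μ : ℝ) (n : ℕ) (x : Euc d) :
    wnorm ω μ n (fun t => g (-t)) x = wnorm ω μ n g (-x) := by
  unfold wnorm
  have := LinearIsometryEquiv.norm_iteratedFDeriv_comp_right (𝕜 := ℝ)
    (LinearIsometryEquiv.neg ℝ (E := Euc d)) g x n
  rw [norm_neg]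
  exact congrArg _ this

theorem RapidDecay.translate {g : Euc d → ℂ} (hg : RapidDecay ω g) (y : Euc d) :
    RapidDecay ω (fun t => g (t - y)) := fun _ hμ n =>
  bdd_of_le fun x => (wnorm_translate_le hμ n g y x).trans
    (mul_le_mul_of_nonneg_left (hg.le_wsup hμ n _) (Real.exp_nonneg _))

theorem RapidDecay.wsup_translate_le {g : Euc d → ℂ} (hg : RapidDecay ω g) (y : Euc d)
    {μ : ℝ} (hμ : 0 < μ) (n : ℕ) :
    wsup ω μ n (fun t => g (t - y)) ≤ Real.exp (μ * ω ‖y‖) * wsup ω μ n g :=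
  wsup_le fun x => (wnorm_translate_le hμ n g y x).trans
    (mul_le_mul_of_nonneg_left (hg.le_wsup hμ n _) (Real.exp_nonneg _))

theorem RapidDecay.wnorm_modulate_le {g : Euc d → ℂ} (hg : RapidDecay ω g)
    (hs : ContDiff ℝ (⊤ : ℕ∞) g) (η : Euc d) {μ : ℝ} (hμ : 0 < μ) (n : ℕ) (x : Euc d) :
    wnorm ω μ n (fun t => character η t * g t) x ≤
      ∑ k ∈ Finset.range (n + 1), ((n.choose k : ℝ) * ‖η‖ ^ k) * wsup ω μ (n - k) g :=
  (GaborWF.wnorm_modulate_le hs μ n η x).trans (Finset.sum_le_sum fun _ _ =>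
    mul_le_mul_of_nonneg_left (hg.le_wsup hμ _ x) (by positivity))

theorem RapidDecay.modulate {g : Euc d → ℂ} (hg : RapidDecay ω g)
    (hs : ContDiff ℝ (⊤ : ℕ∞) g) (η : Euc d) :
    RapidDecay ω (fun t => character η t * g t) := fun _ hμ n =>
  bdd_of_le fun x => hg.wnorm_modulate_le hs η hμ n x

theorem RapidDecay.wsup_modulate_le {g : Euc d → ℂ} (hg : RapidDecay ω g)
    (hs : ContDiff ℝ (⊤ : ℕ∞) g) (η : Euc d) {μ : ℝ} (hμ : 0 < μ) (n : ℕ) :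
    wsup ω μ n (fun t => character η t * g t) ≤
      ∑ k ∈ Finset.range (n + 1), ((n.choose k : ℝ) * ‖η‖ ^ k) * wsup ω μ (n - k) g :=
  wsup_le fun x => hg.wnorm_modulate_le hs η hμ n x

theorem RapidDecay.conj {g : Euc d → ℂ} (hg : RapidDecay ω g) :
    RapidDecay ω (fun t => conj (g t)) := fun _ hμ n =>
  bdd_of_le fun x => (wnorm_conj g _ n x).le.trans (hg.le_wsup hμ n x)

theorem RapidDecay.neg {g : Euc d → ℂ} (hg : RapidDecay ω g) :
    RapidDecay ω (fun t => g (-t)) := fun _ hμ n =>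
  bdd_of_le fun x => (wnorm_neg g _ n x).le.trans (hg.le_wsup hμ n (-x))

theorem RapidDecay.add {f g : Euc d → ℂ} (hf : RapidDecay ω f) (hg : RapidDecay ω g)
    (hfs : ContDiff ℝ (⊤ : ℕ∞) f) (hgs : ContDiff ℝ (⊤ : ℕ∞) g) : RapidDecay ω (f + g) :=
  fun _ hμ n => bdd_of_le fun x => (wnorm_add_le hfs hgs _ n x).trans
    (add_le_add (hf.le_wsup hμ n x) (hg.le_wsup hμ n x))

theorem RapidDecay.wsup_add_le {f g : Euc d → ℂ} (hf : RapidDecay ω f) (hg : RapidDecay ω g)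
    (hfs : ContDiff ℝ (⊤ : ℕ∞) f) (hgs : ContDiff ℝ (⊤ : ℕ∞) g) {μ : ℝ} (hμ : 0 < μ) (n : ℕ) :
    wsup ω μ n (f + g) ≤ wsup ω μ n f + wsup ω μ n g :=
  wsup_le fun x => (wnorm_add_le hfs hgs _ n x).trans
    (add_le_add (hf.le_wsup hμ n x) (hg.le_wsup hμ n x))

theorem RapidDecay.smul {f : Euc d → ℂ} (hf : RapidDecay ω f)
    (hfs : ContDiff ℝ (⊤ : ℕ∞) f) (c : ℂ) : RapidDecay ω (c • f) :=
  fun _ hμ n => bdd_of_le fun x => (wnorm_smul hfs c _ n x).le.trans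
    (mul_le_mul_of_nonneg_left (hf.le_wsup hμ n x) (norm_nonneg c))

end Estimates

section Fourier

variable {d : ℕ}

theorem fourierHat_eq (f : Euc d → ℂ) (ξ : Euc d) :
    fourierHat f ξ = 𝓕 f ((2 * Real.pi)⁻¹ • ξ) := by
  rw [Real.fourier_eq]
  unfold fourierHat
  congr 1
  funext x
  rw [Circle.smul_def, Real.fourierChar_apply, smul_eq_mul, inner_smul_right]
  congr 2
  have : (Real.pi : ℂ) ≠ 0 := by exact_mod_cast Real.pi_ne_zero
  push_cast
  field_simp

theorem contDiff_fourierHat (f : 𝓢(Euc d, ℂ)) : ContDiff ℝ (⊤ : ℕ∞) (fourierHat f) := by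
  have h : fourierHat f = (𝓕 f : 𝓢(Euc d, ℂ)) ∘ fun ξ => (2 * Real.pi)⁻¹ • ξ := by
    funext ξ
    rw [fourierHat_eq, Function.comp_apply, SchwartzMap.fourier_coe]
  rw [h]
  exact (SchwartzMap.smooth _ _).comp (by fun_prop)

theorem integrable_fourierHat (f : 𝓢(Euc d, ℂ)) (ξ : Euc d) :
    MeasureTheory.Integrable
      (fun x => Complex.exp (-(Complex.I * ((inner ℝ x ξ : ℝ) : ℂ))) * f x) := by
  refine (f.integrable (μ := MeasureTheory.volume)).bdd_mul (c := 1)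
    (Continuous.aestronglyMeasurable (by fun_prop)) (Filter.Eventually.of_forall fun x => ?_)
  rw [mul_comm, ← neg_mul, ← Complex.ofReal_neg, Complex.norm_exp_ofReal_mul_I]

theorem fourierHat_zero : fourierHat (0 : Euc d → ℂ) = 0 := by
  funext ξ; simp [fourierHat]

theorem fourierHat_add (f g : 𝓢(Euc d, ℂ)) :
    fourierHat (⇑f + ⇑g) = fourierHat f + fourierHat g := by
  funext ξ
  simp only [fourierHat, Pi.add_apply, mul_add]
  exact MeasureTheory.integral_add (integrable_fourierHat f ξ) (integrable_fourierHat g ξ)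

theorem fourierHat_smul (c : ℂ) (f : Euc d → ℂ) : fourierHat (c • f) = c • fourierHat f := by
  funext ξ
  simp only [fourierHat, Pi.smul_apply, smul_eq_mul]
  rw [← MeasureTheory.integral_const_mul]
  congr 1
  funext x
  ring

theorem fourierHat_translate (f : Euc d → ℂ) (y : Euc d) :
    fourierHat (fun t => f (t - y)) = fun ξ => character (-y) ξ * fourierHat f ξ := by
  funext ξ
  unfold fourierHat character
  rw [← MeasureTheory.integral_const_mul]
  refine Eq.trans ?_ (MeasureTheory.integral_sub_right_eq_self _ y)
  congr 1
  funext x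
  rw [← mul_assoc, ← Complex.exp_add]
  congr 2
  simp only [inner_sub_left, inner_neg_right, real_inner_comm ξ y]
  push_cast
  ring

theorem fourierHat_modulate (f : Euc d → ℂ) (η : Euc d) :
    fourierHat (fun t => character η t * f t) = fun ξ => fourierHat f (ξ - η) := by
  funext ξ
  unfold fourierHat character
  congr 1
  funext x
  rw [← mul_assoc, ← Complex.exp_add]
  congr 2
  simp only [inner_sub_right]
  push_cast
  ring

theorem fourierHat_conj (f : Euc d → ℂ) :
    fourierHat (fun t => conj (f t)) = fun ξ => conj (fourierHat f (-ξ)) := by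
  funext ξ
  unfold fourierHat
  rw [← integral_conj]
  congr 1
  funext x
  rw [map_mul, ← Complex.exp_conj]
  simp

end Fourier

section Space

/-- The set of all Schwartz functions `f` such that `e^{μ ω} D^α f` and `e^{μ ω} D^α f^` are bounded
for all `μ > 0` and all multi-indices `α`, as a linear subspace. -/
def sOmegaSubmodule (ω : Weight) (d : ℕ) : Submodule ℂ 𝓢(Euc d, ℂ) where
  carrier := {f | RapidDecay ω (⇑f) ∧ RapidDecay ω (fourierHat ⇑f)}
  zero_mem' := by
    have h : RapidDecay ω (0 : Euc d → ℂ) := fun μ _ n =>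
      bdd_of_le (C := 0) fun x => by simp [wnorm]
    exact ⟨h, by rw [FunLike.coe_zero, fourierHat_zero]; exact h⟩
  add_mem' := by
    rintro f g ⟨hf, hf'⟩ ⟨hg, hg'⟩
    refine ⟨hf.add hg (f.smooth _) (g.smooth _), ?_⟩
    show RapidDecay ω (fourierHat (⇑f + ⇑g))
    rw [fourierHat_add]
    exact hf'.add hg' (contDiff_fourierHat f) (contDiff_fourierHat g)
  smul_mem' := by
    rintro c f ⟨hf, hf'⟩
    refine ⟨hf.smul (f.smooth _) c, ?_⟩
    show RapidDecay ω (fourierHat (c • ⇑f))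
    rw [fourierHat_smul]
    exact hf'.smul (contDiff_fourierHat f) c

/-- The weighted Schwartz space `S_ω(ℝ^d)`. It is a type of its own because it does not carry the
topology induced by the Schwartz space. -/
def SOmega (ω : Weight) (d : ℕ) : Type := sOmegaSubmodule ω d

variable {ω : Weight} {d : ℕ}

instance : AddCommGroup (SOmega ω d) := inferInstanceAs (AddCommGroup (sOmegaSubmodule ω d))

instance : Module ℂ (SOmega ω d) := inferInstanceAs (Module ℂ (sOmegaSubmodule ω d))

/-- The underlying Schwartz function. -/
def SOmega.toSchwartz : SOmega ω d →ₗ[ℂ] 𝓢(Euc d, ℂ) := (sOmegaSubmodule ω d).subtype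

instance : CoeFun (SOmega ω d) (fun _ => Euc d → ℂ) := ⟨fun f => ⇑(SOmega.toSchwartz f)⟩

theorem SOmega.ext {f g : SOmega ω d} (h : ∀ x, f x = g x) : f = g :=
  Subtype.ext (SchwartzMap.ext h)

theorem SOmega.decay (f : SOmega ω d) : RapidDecay ω (f : Euc d → ℂ) := f.2.1

theorem SOmega.decay_hat (f : SOmega ω d) : RapidDecay ω (fourierHat (f : Euc d → ℂ)) := f.2.2

theorem SOmega.smooth (f : SOmega ω d) : ContDiff ℝ (⊤ : ℕ∞) (f : Euc d → ℂ) :=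
  f.toSchwartz.smooth _

theorem SOmega.smooth_hat (f : SOmega ω d) : ContDiff ℝ (⊤ : ℕ∞) (fourierHat (f : Euc d → ℂ)) :=
  contDiff_fourierHat f.toSchwartz

/-- The seminorm `sup_x e^{μ ω(x)} |∂^n f(x)|`, for `i = (μ, n)` with `μ > 0`. -/
def seminormTime (ω : Weight) (d : ℕ) (i : Set.Ioi (0 : ℝ) × ℕ) : Seminorm ℂ (SOmega ω d) :=
  Seminorm.of (fun f => wsup ω i.1 i.2 f)
    (fun f g => f.decay.wsup_add_le g.decay f.smooth g.smooth i.1.2 i.2)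
    (fun c f => wsup_smul f.smooth c i.1 i.2)

/-- The seminorm `sup_ξ e^{μ ω(ξ)} |∂^n f^(ξ)|`, for `i = (μ, n)` with `μ > 0`. -/
def seminormFreq (ω : Weight) (d : ℕ) (i : Set.Ioi (0 : ℝ) × ℕ) : Seminorm ℂ (SOmega ω d) :=
  Seminorm.of (fun f => wsup ω i.1 i.2 (fourierHat f))
    (fun f g => by
      have h : fourierHat ((f + g : SOmega ω d) : Euc d → ℂ) = fourierHat f + fourierHat g :=
        fourierHat_add f.toSchwartz g.toSchwartz
      rw [h]
      exact f.decay_hat.wsup_add_le g.decay_hat f.smooth_hat g.smooth_hat i.1.2 i.2)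
    (fun c f => by
      have h : fourierHat ((c • f : SOmega ω d) : Euc d → ℂ) = c • fourierHat f :=
        fourierHat_smul c f
      rw [h]
      exact wsup_smul f.smooth_hat c i.1 i.2)

/-- The defining system of seminorms of `S_ω(ℝ^d)`. -/
def seminormFamily (ω : Weight) (d : ℕ) :
    SeminormFamily ℂ (SOmega ω d) ((Set.Ioi (0 : ℝ) × ℕ) ⊕ (Set.Ioi (0 : ℝ) × ℕ)) :=
  Sum.elim (seminormTime ω d) (seminormFreq ω d)

/-- `S_ω(ℝ^d)` carries the locally convex topology defined by these seminorms. -/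
instance : TopologicalSpace (SOmega ω d) := (seminormFamily ω d).moduleFilterBasis.topology

theorem withSeminorms (ω : Weight) (d : ℕ) : WithSeminorms (seminormFamily ω d) := ⟨rfl⟩

instance : IsTopologicalAddGroup (SOmega ω d) := (withSeminorms ω d).topologicalAddGroup

instance : ContinuousSMul ℂ (SOmega ω d) := (withSeminorms ω d).continuousSMul

theorem continuous_seminormTime (i : Set.Ioi (0 : ℝ) × ℕ) : Continuous (seminormTime ω d i) :=
  (withSeminorms ω d).continuous_seminorm (Sum.inl i)

theorem continuous_seminormFreq (i : Set.Ioi (0 : ℝ) × ℕ) : Continuous (seminormFreq ω d i) :=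
  (withSeminorms ω d).continuous_seminorm (Sum.inr i)

theorem continuous_of_le_continuous (p : Seminorm ℂ (SOmega ω d)) (F : SOmega ω d → ℝ)
    (hF : Continuous F) (h0 : F 0 = 0) (h : ∀ f, p f ≤ F f) : Continuous p := by
  refine Seminorm.continuous_of_continuousAt_zero ?_
  unfold ContinuousAt
  rw [map_zero]
  refine squeeze_zero (fun f => apply_nonneg p f) h ?_
  have := hF.tendsto 0
  rwa [h0] at this

/-- The space `S'_ω(ℝ^d)` of `ω`-tempered distributions: the continuous linear functionals on
`S_ω(ℝ^d)`. -/
abbrev SOmegaDual (ω : Weight) (d : ℕ) : Type := SOmega ω d →L[ℂ] ℂ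

end Space

section Operators

variable {ω : Weight} {d : ℕ}

theorem hasTemperateGrowth_character (η : Euc d) : (character η).HasTemperateGrowth :=
  ⟨contDiff_character η, fun n => ⟨0, ‖η‖ ^ n, fun x => by
    simpa using norm_iteratedFDeriv_character_le η n x⟩⟩

/-- The translation `T_y f(t) = f(t - y)` on `S_ω(ℝ^d)`, as a linear map. -/
def translateLM (y : Euc d) : SOmega ω d →ₗ[ℂ] SOmega ω d :=
  LinearMap.restrict (p := sOmegaSubmodule ω d) (q := sOmegaSubmodule ω d)
    (SchwartzMap.compSubConstCLM ℂ y : 𝓢(Euc d, ℂ) →L[ℂ] 𝓢(Euc d, ℂ)).toLinearMap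
    (by
      rintro f ⟨hf, hf'⟩
      refine ⟨hf.translate y, ?_⟩
      show RapidDecay ω (fourierHat fun t => f (t - y))
      rw [fourierHat_translate]
      exact hf'.modulate (contDiff_fourierHat f) (-y))

theorem translateLM_apply (y : Euc d) (f : SOmega ω d) (t : Euc d) :
    translateLM y f t = f (t - y) := rfl

/-- The modulation `M_η f(t) = e^{i⟨t,η⟩} f(t)` on `S_ω(ℝ^d)`, as a linear map. -/
def modulateLM (η : Euc d) : SOmega ω d →ₗ[ℂ] SOmega ω d :=
  LinearMap.restrict (p := sOmegaSubmodule ω d) (q := sOmegaSubmodule ω d)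
    (SchwartzMap.smulLeftCLM ℂ (character η) : 𝓢(Euc d, ℂ) →L[ℂ] 𝓢(Euc d, ℂ)).toLinearMap
    (by
      rintro f ⟨hf, hf'⟩
      have h : ⇑(SchwartzMap.smulLeftCLM ℂ (character η) f) = fun t => character η t * f t := by
        funext t
        rw [SchwartzMap.smulLeftCLM_apply_apply (hasTemperateGrowth_character η), smul_eq_mul]
      show RapidDecay ω (⇑(SchwartzMap.smulLeftCLM ℂ (character η) f)) ∧
        RapidDecay ω (fourierHat ⇑(SchwartzMap.smulLeftCLM ℂ (character η) f))
      rw [h, fourierHat_modulate]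
      exact ⟨hf.modulate (f.smooth _) η, hf'.translate η⟩)

theorem modulateLM_apply (η : Euc d) (f : SOmega ω d) (t : Euc d) :
    modulateLM η f t = character η t * f t := by
  show (SchwartzMap.smulLeftCLM ℂ (character η) f.toSchwartz) t = _
  rw [SchwartzMap.smulLeftCLM_apply_apply (hasTemperateGrowth_character η), smul_eq_mul]

theorem continuous_translateLM (y : Euc d) :
    Continuous (translateLM y : SOmega ω d →ₗ[ℂ] SOmega ω d) := by
  refine WithSeminorms.continuous_of_continuous_comp (withSeminorms ω d) _ ?_
  rintro (i | i)
  · refine continuous_of_le_continuous _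
      (fun f => Real.exp (i.1 * ω ‖y‖) * seminormTime ω d i f) ?_ (by simp) fun f => ?_
    · exact continuous_const.mul (continuous_seminormTime i)
    · exact f.decay.wsup_translate_le y i.1.2 i.2
  · refine continuous_of_le_continuous _
      (fun f => ∑ k ∈ Finset.range (i.2 + 1),
        ((i.2.choose k : ℝ) * ‖-y‖ ^ k) * seminormFreq ω d (i.1, i.2 - k) f) ?_ (by simp)
      fun f => ?_
    · exact continuous_finsetSum _ fun k _ =>
        continuous_const.mul (continuous_seminormFreq _)
    · have h : fourierHat (translateLM y f) = fun ξ => character (-y) ξ * fourierHat f ξ :=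
        fourierHat_translate f y
      show wsup ω i.1 i.2 (fourierHat (translateLM y f)) ≤ _
      rw [h]
      exact f.decay_hat.wsup_modulate_le f.smooth_hat (-y) i.1.2 i.2

theorem continuous_modulateLM (η : Euc d) :
    Continuous (modulateLM η : SOmega ω d →ₗ[ℂ] SOmega ω d) := by
  refine WithSeminorms.continuous_of_continuous_comp (withSeminorms ω d) _ ?_
  have hfun : ∀ f : SOmega ω d, ((modulateLM η f : SOmega ω d) : Euc d → ℂ) =
      fun t => character η t * f t := fun f => funext fun t => modulateLM_apply η f t
  rintro (i | i)
  · refine continuous_of_le_continuous _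
      (fun f => ∑ k ∈ Finset.range (i.2 + 1),
        ((i.2.choose k : ℝ) * ‖η‖ ^ k) * seminormTime ω d (i.1, i.2 - k) f) ?_ (by simp)
      fun f => ?_
    · exact continuous_finsetSum _ fun k _ =>
        continuous_const.mul (continuous_seminormTime _)
    · show wsup ω i.1 i.2 (modulateLM η f) ≤ _
      rw [hfun]
      exact f.decay.wsup_modulate_le f.smooth η i.1.2 i.2
  · refine continuous_of_le_continuous _
      (fun f => Real.exp (i.1 * ω ‖η‖) * seminormFreq ω d i f) ?_ (by simp) fun f => ?_
    · exact continuous_const.mul (continuous_seminormFreq i)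
    · show wsup ω i.1 i.2 (fourierHat (modulateLM η f)) ≤ _
      rw [hfun, fourierHat_modulate]
      exact f.decay_hat.wsup_translate_le η i.1.2 i.2

/-- The translation operator `T_y f(t) = f(t - y)` on `S_ω(ℝ^d)`. -/
def translate (y : Euc d) : SOmega ω d →L[ℂ] SOmega ω d :=
  ⟨translateLM y, continuous_translateLM y⟩

/-- The modulation operator `M_η f(t) = e^{i⟨t,η⟩} f(t)` on `S_ω(ℝ^d)`. -/
def modulate (η : Euc d) : SOmega ω d →L[ℂ] SOmega ω d :=
  ⟨modulateLM η, continuous_modulateLM η⟩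

/-- The phase-space shift `Π(z) = M_ξ T_x` on `S_ω(ℝ^d)`, for `z = (x, ξ)`. -/
def shift (z : PhaseSpace d) : SOmega ω d →L[ℂ] SOmega ω d :=
  (modulate z.snd).comp (translate z.fst)

theorem shift_apply (z : PhaseSpace d) (f : SOmega ω d) (t : Euc d) :
    shift z f t = Complex.exp (Complex.I * ((inner ℝ t z.snd : ℝ) : ℂ)) * f (t - z.fst) :=
  modulateLM_apply z.snd (translateLM z.fst f) t

/-- The pointwise complex conjugate of a function in `S_ω(ℝ^d)`. -/
def conjFun (f : SOmega ω d) : SOmega ω d :=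
  ⟨{ toFun := fun t => conj (f t)
     smooth' := Complex.conjCLE.contDiff.comp f.smooth
     decay' := fun k n => by
      obtain ⟨C, hC⟩ := f.toSchwartz.decay' k n
      refine ⟨C, fun x => ?_⟩
      have h := LinearIsometryEquiv.norm_iteratedFDeriv_comp_left (𝕜 := ℝ) Complex.conjLIE
        (f : Euc d → ℂ) x n
      have h' : ‖iteratedFDeriv ℝ n (fun t => conj (f t)) x‖ =
        ‖iteratedFDeriv ℝ n (f : Euc d → ℂ) x‖ := h
      rw [h']
      exact hC x },
    f.decay.conj, by
      show RapidDecay ω (fourierHat fun t => conj (f t))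
      rw [fourierHat_conj]
      exact f.decay_hat.neg.conj⟩

theorem conjFun_apply (f : SOmega ω d) (t : Euc d) : conjFun f t = conj (f t) := rfl

/-- Translation of distributions, `(T_y u)(f) = u(T_{-y} f)`; it extends the translation of
functions, `∫ g(t - y) f(t) dt = ∫ g(t) f(t + y) dt`. -/
def dualTranslate (y : Euc d) (u : SOmegaDual ω d) : SOmegaDual ω d :=
  u.comp (translate (-y))

/-- Modulation of distributions, `(M_η u)(f) = u(M_η f)`; it extends the modulation of functions,
`∫ e^{i⟨t,η⟩} g(t) f(t) dt = ∫ g(t) e^{i⟨t,η⟩} f(t) dt`. -/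
def dualModulate (η : Euc d) (u : SOmegaDual ω d) : SOmegaDual ω d :=
  u.comp (modulate η)

/-- The phase-space shift `Π(w) u = M_η T_y u` of a distribution `u`, for `w = (y, η)`. -/
def dualShift (w : PhaseSpace d) (u : SOmegaDual ω d) : SOmegaDual ω d :=
  dualModulate w.snd (dualTranslate w.fst u)

/-- The conjugate linear action `⟨u, φ⟩ = u(φ̄)` of `S'_ω` on `S_ω`, which is consistent with the
inner product `⟨g, φ⟩ = ∫ g(t) φ̄(t) dt` of `L²`. -/
def pairing (u : SOmegaDual ω d) (φ : SOmega ω d) : ℂ := u (conjFun φ)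

/-- The short-time Fourier transform `V_φ u(z) = ⟨u, Π(z) φ⟩` with window `φ`. -/
def stft (φ : SOmega ω d) (u : SOmegaDual ω d) (z : PhaseSpace d) : ℂ :=
  pairing u (shift z φ)

end Operators

section WaveFrontSet

variable {ω : Weight} {d : ℕ}

/-- A conic set: a set that is invariant under multiplication by positive scalars. -/
def IsConic (Γ : Set (PhaseSpace d)) : Prop :=
  ∀ z ∈ Γ, ∀ t : ℝ, 0 < t → t • z ∈ Γ

/-- The `ω`-wave front set of `u`, computed with the window `φ`. A point `z₀ ≠ 0` does not belong to
it if there is an open conic set `Γ` not containing `0`, with `z₀ ∈ Γ`, such that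
`sup_{z ∈ Γ} e^{μ ω(z)} |V_φ u(z)| < ∞` for all `μ > 0`. -/
def waveFrontSet (φ : SOmega ω d) (u : SOmegaDual ω d) : Set (PhaseSpace d) :=
  {z₀ | z₀ ≠ 0 ∧ ¬ ∃ Γ : Set (PhaseSpace d), IsOpen Γ ∧ IsConic Γ ∧ (0 : PhaseSpace d) ∉ Γ ∧
    z₀ ∈ Γ ∧ ∀ μ : ℝ, 0 < μ →
      BddAbove ((fun z => Real.exp (μ * ω ‖z‖) * ‖stft φ u z‖) '' Γ)}

end WaveFrontSet

end GaborWF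

end

noncomputable section

namespace GaborWF

/-! ### Consequences of subadditivity and of `log t = o(ω(t))` -/

section WeightEstimates

variable {d : ℕ} {ω : Weight}

/-! A phase-space shift of `u` only translates its short-time Fourier transform: `|V_φ(Π(w)u)(z)| =
|V_φ u(z - w)|` (`norm_stft_dualShift`). Invariance under shifts and independence of the window
therefore follow from one comparison between `V_φ u` and `V_ψ u`, each translated by a fixed vector.

The comparison rests on the reproducing formula `integral_coef_mul_stft`. Applied to `f =
conj(Π(z)φ)`, it writes `V_φ u(z)` as a multiple of the integral over `w` of `V_ψ u(w)` against the
kernel `∫ conj(Π(z)φ) Π(w)ψ`. This kernel is `O(e^{-μ ω(w - z)})` for every `μ > 0`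
(`exists_coef_conj_shift_le`): decay in position is read off directly, decay in frequency through
Parseval. Fixed translations cost only constants, by subadditivity (`exists_norm_stft_sub_le`).

It remains to see that convolution with such kernels preserves rapid decay in cones, after shrinking
the cone (`exists_cone_decay`). For `z` in the smaller cone and `w` in the larger one, `G(w)` decays
and `ω(z) ≤ ω(w) + ω(w - z)`. For `w` outside the larger cone, `|z|` is at most a multiple of `|w -
z|`, so the decay of the kernel beats both the moderate growth of `G` and the factor `e^{μ ω(z)}`.

The analytic core is the reproducing formula for distributions. For functions it is Fourier
inversion. To apply `u` under the integral, continuity bounds `u` by finitely many seminorms, each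
of which is the norm of a weighted derivative in a Banach space of bounded continuous functions. By
Hahn–Banach `u` factors through a finite product of these spaces, where the integral is a Bochner
integral and commutes with bounded functionals. -/

theorem Weight.mono (ω : Weight) {s t : ℝ} (hs : 0 ≤ s) (h : s ≤ t) : ω s ≤ ω t :=
  ω.monotoneOn hs (hs.trans h) h

theorem Weight.norm_add_le {E : Type*} [SeminormedAddCommGroup E] (ω : Weight) (x y : E) :
    ω ‖x + y‖ ≤ ω ‖x‖ + ω ‖y‖ :=
  (ω.mono (norm_nonneg _) (_root_.norm_add_le x y)).trans
    (ω.subadditive _ _ (norm_nonneg _) (norm_nonneg _))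

theorem Weight.norm_sub_le {E : Type*} [SeminormedAddCommGroup E] (ω : Weight) (x y : E) :
    ω ‖x - y‖ ≤ ω ‖x‖ + ω ‖y‖ := by
  simpa [sub_eq_add_neg] using ω.norm_add_le x (-y)

theorem Weight.norm_nonneg {E : Type*} [SeminormedAddCommGroup E] (ω : Weight) (x : E) :
    0 ≤ ω ‖x‖ := ω.nonneg _ (_root_.norm_nonneg x)

theorem Weight.nat_succ_mul_le (ω : Weight) (n : ℕ) {t : ℝ} (ht : 0 ≤ t) :
    ω ((n + 1) * t) ≤ (n + 1) * ω t := by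
  induction n with
  | zero => simp
  | succ n ih =>
    have h := ω.subadditive ((n + 1) * t) t (by positivity) ht
    push_cast
    calc ω ((n + 1 + 1) * t) = ω ((n + 1) * t + t) := by congr 1; ring
      _ ≤ _ := by linarith

theorem Weight.continuous_norm {E : Type*} [SeminormedAddCommGroup E] (ω : Weight) :
    Continuous fun x : E => ω ‖x‖ :=
  ω.continuousOn.comp_continuous _root_.continuous_norm fun x => _root_.norm_nonneg x

/-- Since `log t ≤ ω(t)` for large `t`, the exponential `e^ω` dominates `t` there; the rest is a
bounded interval. All later absorptions of polynomial factors into `e^{Mω}`, and the integrability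
of `e^{-μω}`, come from this bound. -/
theorem Weight.exists_one_add_le (ω : Weight) :
    ∃ C : ℝ, 1 ≤ C ∧ ∀ t : ℝ, 0 ≤ t → 1 + t ≤ C * Real.exp (ω t) := by
  obtain ⟨T, hT⟩ := Filter.eventually_atTop.1 (ω.log_isLittleO.bound one_pos)
  refine ⟨2 + |T|, by linarith [abs_nonneg T], fun t ht => ?_⟩
  have he : 1 ≤ Real.exp (ω t) := Real.one_le_exp (ω.nonneg t ht)
  by_cases h : t ≤ 1 + |T|
  · nlinarith [abs_nonneg T]
  · push Not at h
    have h1 : 1 < t := by linarith [abs_nonneg T]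
    have h2 := hT t (by linarith [le_abs_self T])
    rw [one_mul, Real.norm_of_nonneg (Real.log_nonneg h1.le),
      Real.norm_of_nonneg (ω.nonneg t ht)] at h2
    have h3 : t ≤ Real.exp (ω t) := (Real.log_le_iff_le_exp (by linarith)).1 h2
    nlinarith [abs_nonneg T]

theorem Weight.exists_one_add_pow_le (ω : Weight) (n : ℕ) :
    ∃ C : ℝ, 0 ≤ C ∧ ∀ t : ℝ, 0 ≤ t → (1 + t) ^ n ≤ C * Real.exp (n * ω t) := by
  obtain ⟨C, hC, h⟩ := ω.exists_one_add_le
  refine ⟨C ^ n, by positivity, fun t ht => ?_⟩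
  rw [Real.exp_nat_mul, ← mul_pow]
  exact pow_le_pow_left₀ (by positivity) (h t ht) n

theorem integrable_exp_weight (ω : Weight) (d : ℕ) {μ : ℝ} (hμ : d + 1 ≤ μ) :
    MeasureTheory.Integrable fun x : Euc d => Real.exp (-(μ * ω ‖x‖)) := by
  obtain ⟨C, hC, h⟩ := ω.exists_one_add_pow_le (d + 1)
  have hi := (integrable_one_add_norm (E := Euc d) (μ := MeasureTheory.volume)
    (r := (d + 1 : ℕ)) (by simp)).const_mul C
  refine hi.mono' (Continuous.aestronglyMeasurable (by
    have := ω.continuous_norm (E := Euc d)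
    fun_prop)) (Filter.Eventually.of_forall fun x => ?_)
  rw [Real.norm_of_nonneg (Real.exp_nonneg _), Real.rpow_neg (by positivity), Real.rpow_natCast,
    Real.exp_neg, ← div_eq_mul_inv, le_div_iff₀ (by positivity), inv_mul_le_iff₀ (by positivity),
    mul_comm]
  refine (h _ (norm_nonneg x)).trans ?_
  gcongr
  · exact ω.norm_nonneg x
  · push_cast; exact hμ

theorem norm_fst_le (z : PhaseSpace d) : ‖z.fst‖ ≤ ‖z‖ := by
  rw [WithLp.prod_norm_eq_of_L2]
  exact Real.le_sqrt_of_sq_le (by nlinarith [sq_nonneg ‖z.snd‖])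

theorem norm_snd_le (z : PhaseSpace d) : ‖z.snd‖ ≤ ‖z‖ := by
  rw [WithLp.prod_norm_eq_of_L2]
  exact Real.le_sqrt_of_sq_le (by nlinarith [sq_nonneg ‖z.fst‖])

theorem weight_fst_le (ω : Weight) (z : PhaseSpace d) : ω ‖z.fst‖ ≤ ω ‖z‖ :=
  ω.mono (norm_nonneg _) (norm_fst_le z)

theorem weight_snd_le (ω : Weight) (z : PhaseSpace d) : ω ‖z.snd‖ ≤ ω ‖z‖ :=
  ω.mono (norm_nonneg _) (norm_snd_le z)

theorem weight_le_fst_add_snd (ω : Weight) (z : PhaseSpace d) :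
    ω ‖z‖ ≤ ω ‖z.fst‖ + ω ‖z.snd‖ := by
  refine (ω.mono (norm_nonneg _) ?_).trans (ω.subadditive _ _ (norm_nonneg _) (norm_nonneg _))
  rw [WithLp.prod_norm_eq_of_L2]
  refine Real.sqrt_le_iff.2 ⟨by positivity, ?_⟩
  nlinarith [norm_nonneg z.fst, norm_nonneg z.snd]

/-- The point `(x, ξ)` of the phase space. -/
def toPhase (p : Euc d × Euc d) : PhaseSpace d := WithLp.toLp 2 p

@[simp] theorem toPhase_fst (p : Euc d × Euc d) : (toPhase p).fst = p.1 := rfl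

@[simp] theorem toPhase_snd (p : Euc d × Euc d) : (toPhase p).snd = p.2 := rfl

theorem continuous_toPhase : Continuous (toPhase : Euc d × Euc d → PhaseSpace d) :=
  WithLp.prod_continuous_toLp 2 _ _

theorem integrable_exp_weight_phase (ω : Weight) (d : ℕ) (z : PhaseSpace d) {μ : ℝ}
    (hμ : 2 * (d + 1) ≤ μ) :
    MeasureTheory.Integrable
      fun p : Euc d × Euc d => Real.exp (-(μ * ω ‖toPhase p - z‖)) := by
  have hμ0 : 0 ≤ μ := le_trans (by positivity) hμ
  -- Both `ω(x)` and `ω(ξ)` are at most `ω(x, ξ)`, so half of the rate goes to each factor and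
  -- Fubini applies.
  have h1 := integrable_exp_weight ω d (μ := μ / 2) (by linarith)
  have h2 := (h1.comp_sub_right z.fst).mul_prod (h1.comp_sub_right z.snd)
  refine h2.mono' (Continuous.aestronglyMeasurable ?_) (Filter.Eventually.of_forall fun p => ?_)
  · have := (ω.continuous_norm (E := PhaseSpace d)).comp
      (continuous_toPhase.sub (continuous_const (y := z)))
    exact (continuous_const.mul this).neg.rexp
  · rw [Real.norm_of_nonneg (Real.exp_nonneg _), ← Real.exp_add, Real.exp_le_exp]
    have a := weight_fst_le ω (toPhase p - z)
    have b := weight_snd_le ω (toPhase p - z)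
    change ω ‖p.1 - z.fst‖ ≤ _ at a
    change ω ‖p.2 - z.snd‖ ≤ _ at b
    nlinarith

/-- The integral of `e^{-μ ω}` over the phase space does not depend on the centre. -/
theorem integral_exp_weight_phase (ω : Weight) (d : ℕ) (z : PhaseSpace d) (μ : ℝ) :
    ∫ p : Euc d × Euc d, Real.exp (-(μ * ω ‖toPhase p - z‖)) =
      ∫ p : Euc d × Euc d, Real.exp (-(μ * ω ‖toPhase p‖)) := by
  have : (MeasureTheory.volume : MeasureTheory.Measure (Euc d × Euc d)).IsAddRightInvariant :=
    inferInstanceAs (MeasureTheory.Measure.prod MeasureTheory.volume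
      MeasureTheory.volume).IsAddRightInvariant
  exact MeasureTheory.integral_sub_right_eq_self
    (fun p : Euc d × Euc d => Real.exp (-(μ * ω ‖toPhase p‖))) (WithLp.ofLp z)

end WeightEstimates

/-! ### Continuity and moderate growth of `z ↦ Π(z)f` in `S_ω` -/

section ShiftContinuity

variable {d : ℕ} {ω : Weight}

open Filter Topology

/-- Mean value inequality for the `n`-th derivative on the ball of radius `‖y‖` about `x`; on this
ball the weight at `x` exceeds the weight at the moving point by at most `ω(y)`. -/
theorem RapidDecay.wsup_translate_sub_le {g : Euc d → ℂ} (hg : RapidDecay ω g)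
    (hs : ContDiff ℝ (⊤ : ℕ∞) g) {μ : ℝ} (hμ : 0 < μ) (n : ℕ) (y : Euc d) :
    wsup ω μ n (fun t => g (t - y) - g t) ≤
      ‖y‖ * (Real.exp (μ * ω ‖y‖) * wsup ω μ (n + 1) g) := by
  refine wsup_le fun x => ?_
  have hts : ContDiff ℝ (⊤ : ℕ∞) fun t => g (t - y) := hs.comp (contDiff_id.sub contDiff_const)
  have e : iteratedFDeriv ℝ n (fun t => g (t - y) - g t) x =
      iteratedFDeriv ℝ n g (x - y) - iteratedFDeriv ℝ n g x := by
    rw [← iteratedFDeriv_comp_sub]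
    exact iteratedFDeriv_sub_apply (contDiff_nat hts n).contDiffAt (contDiff_nat hs n).contDiffAt
  have hb : ∀ z ∈ Metric.closedBall x ‖y‖, ‖fderiv ℝ (iteratedFDeriv ℝ n g) z‖ ≤
      Real.exp (-(μ * ω ‖x‖)) * (Real.exp (μ * ω ‖y‖) * wsup ω μ (n + 1) g) := by
    intro z hz
    rw [norm_fderiv_iteratedFDeriv]
    have h1 := hg.le_wsup hμ (n + 1) z
    have h2 : ω ‖x‖ ≤ ω ‖z‖ + ω ‖y‖ := (weight_norm_le ω x z).trans (by
      gcongr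
      refine ω.mono (norm_nonneg _) ?_
      rwa [← dist_eq_norm, dist_comm])
    rw [wnorm] at h1
    rw [Real.exp_neg, ← div_eq_inv_mul, le_div_iff₀ (Real.exp_pos _), mul_comm]
    calc _ ≤ Real.exp (μ * ω ‖y‖) *
          (Real.exp (μ * ω ‖z‖) * ‖iteratedFDeriv ℝ (n + 1) g z‖) := by
          rw [← mul_assoc, ← Real.exp_add]
          gcongr
          nlinarith
      _ ≤ _ := by gcongr
  have hmv := (convex_closedBall x ‖y‖).norm_image_sub_le_of_norm_fderiv_le (𝕜 := ℝ)
    (fun z _ => ((contDiff_nat hs (n + 1)).differentiable_iteratedFDeriv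
      (by exact_mod_cast n.lt_succ_self)).differentiableAt) hb
    (Metric.mem_closedBall_self (norm_nonneg y))
    (show x - y ∈ Metric.closedBall x ‖y‖ by simp)
  unfold wnorm
  rw [e]
  refine (mul_le_mul_of_nonneg_left hmv (Real.exp_nonneg _)).trans (le_of_eq ?_)
  rw [show x - y - x = -y by abel, norm_neg, Real.exp_neg]
  field_simp

theorem norm_iteratedFDeriv_character_sub_one_le {η : Euc d} (hη : ‖η‖ ≤ 1) (n : ℕ)
    (x : Euc d) :
    ‖iteratedFDeriv ℝ n (fun t => character η t - 1) x‖ ≤ ‖η‖ * (1 + ‖x‖) := by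
  have e : iteratedFDeriv ℝ n (fun t => character η t - 1) x =
      iteratedFDeriv ℝ n (character η) x - iteratedFDeriv ℝ n (fun _ : Euc d => (1 : ℂ)) x :=
    iteratedFDeriv_sub_apply (contDiff_nat (contDiff_character η) n).contDiffAt contDiff_const.contDiffAt
  -- For order zero, `|e^{is} - 1| ≤ |s|` produces the factor `‖x‖`. For positive order the constant
  -- disappears and `‖η‖ ^ n ≤ ‖η‖`.
  rcases Nat.eq_zero_or_pos n with rfl | hn
  · rw [norm_iteratedFDeriv_zero]
    refine (Real.norm_exp_I_mul_ofReal_sub_one_le).trans ?_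
    have := norm_inner_le_norm (𝕜 := ℝ) x η
    nlinarith [norm_nonneg η, norm_nonneg x]
  · rw [e, iteratedFDeriv_const_of_ne hn.ne', Pi.zero_apply, sub_zero]
    refine (norm_iteratedFDeriv_character_le η n x).trans ?_
    calc ‖η‖ ^ n ≤ ‖η‖ ^ 1 := pow_le_pow_of_le_one (norm_nonneg _) hη hn
      _ ≤ _ := by nlinarith [norm_nonneg η, norm_nonneg x]

theorem RapidDecay.exists_wsup_modulate_sub_le {g : Euc d → ℂ} (hg : RapidDecay ω g)
    (hs : ContDiff ℝ (⊤ : ℕ∞) g) {μ : ℝ} (hμ : 0 < μ) (n : ℕ) :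
    ∃ C : ℝ, ∀ η : Euc d, ‖η‖ ≤ 1 →
      wsup ω μ n (fun t => character η t * g t - g t) ≤ ‖η‖ * C := by
  obtain ⟨C, hC, hC'⟩ := ω.exists_one_add_le
  -- The rate `μ + 1` pays for the factor `1 + ‖x‖ ≤ C e^{ω(x)}` in the bound for `e^{i⟨x,η⟩} - 1`.
  refine ⟨∑ k ∈ Finset.range (n + 1), (n.choose k : ℝ) * C * wsup ω (μ + 1) (n - k) g,
    fun η hη => wsup_le fun x => ?_⟩
  have e : (fun t => character η t * g t - g t) = fun t => (character η t - 1) * g t := by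
    funext t; ring
  rw [e, wnorm]
  refine (mul_le_mul_of_nonneg_left (norm_iteratedFDeriv_mul_le
    ((contDiff_character η).sub contDiff_const) hs x
    (by exact_mod_cast le_top)) (Real.exp_nonneg _)).trans ?_
  rw [Finset.mul_sum, Finset.mul_sum]
  refine Finset.sum_le_sum fun k _ => ?_
  have h1 := norm_iteratedFDeriv_character_sub_one_le hη k x
  have h2 := hg.le_wsup (μ := μ + 1) (by linarith) (n - k) x
  rw [wnorm, add_mul, one_mul, Real.exp_add] at h2
  have h3 := hC' ‖x‖ (norm_nonneg x)
  calc _ ≤ Real.exp (μ * ω ‖x‖) * ((n.choose k : ℝ) * (‖η‖ * (C * Real.exp (ω ‖x‖))) *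
        ‖iteratedFDeriv ℝ (n - k) g x‖) := by
        gcongr
        exact h1.trans (by gcongr)
    _ = ‖η‖ * ((n.choose k : ℝ) * C * (Real.exp (μ * ω ‖x‖) * Real.exp (ω ‖x‖) *
        ‖iteratedFDeriv ℝ (n - k) g x‖)) := by ring
    _ ≤ _ := by gcongr

theorem RapidDecay.tendsto_wsup_translate_sub {g : Euc d → ℂ} (hg : RapidDecay ω g)
    (hs : ContDiff ℝ (⊤ : ℕ∞) g) {μ : ℝ} (hμ : 0 < μ) (n : ℕ) :
    Tendsto (fun y : Euc d => wsup ω μ n (fun t => g (t - y) - g t)) (𝓝 0) (𝓝 0) := by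
  refine squeeze_zero (fun y => wsup_nonneg _ _ _ _)
    (fun y => hg.wsup_translate_sub_le hs hμ n y) ?_
  have hc : Continuous fun y : Euc d => ‖y‖ * (Real.exp (μ * ω ‖y‖) * wsup ω μ (n + 1) g) := by
    have := ω.continuous_norm (E := Euc d)
    fun_prop
  simpa using hc.tendsto 0

theorem RapidDecay.tendsto_wsup_modulate_sub {g : Euc d → ℂ} (hg : RapidDecay ω g)
    (hs : ContDiff ℝ (⊤ : ℕ∞) g) {μ : ℝ} (hμ : 0 < μ) (n : ℕ) :
    Tendsto (fun η : Euc d => wsup ω μ n (fun t => character η t * g t - g t)) (𝓝 0) (𝓝 0) := by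
  obtain ⟨C, hC⟩ := hg.exists_wsup_modulate_sub_le hs hμ n
  have hb : ∀ᶠ η : Euc d in 𝓝 0, ‖η‖ ≤ 1 := by
    filter_upwards [Metric.closedBall_mem_nhds (0 : Euc d) one_pos] with η hη
    simpa using hη
  refine squeeze_zero' (Eventually.of_forall fun y => wsup_nonneg _ _ _ _)
    (hb.mono fun η hη => hC η hη) ?_
  have hc : Continuous fun y : Euc d => ‖y‖ * C := by fun_prop
  simpa using hc.tendsto 0

theorem modulate_apply (η : Euc d) (f : SOmega ω d) (t : Euc d) :
    modulate η f t = character η t * f t := modulateLM_apply η f t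

theorem translate_apply (y : Euc d) (f : SOmega ω d) (t : Euc d) :
    translate y f t = f (t - y) := rfl

theorem coe_modulate (η : Euc d) (f : SOmega ω d) :
    ((modulate η f : SOmega ω d) : Euc d → ℂ) = fun t => character η t * f t :=
  funext fun t => modulate_apply η f t

theorem fourierHat_coe_modulate (η : Euc d) (f : SOmega ω d) :
    fourierHat (modulate η f) = fun ξ => fourierHat f (ξ - η) := by
  rw [coe_modulate, fourierHat_modulate]

theorem fourierHat_coe_translate (y : Euc d) (f : SOmega ω d) :
    fourierHat (translate y f) = fun ξ => character (-y) ξ * fourierHat f ξ :=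
  fourierHat_translate f y

theorem SOmega.coe_sub (f g : SOmega ω d) :
    ((f - g : SOmega ω d) : Euc d → ℂ) = fun t => f t - g t := rfl

theorem SOmega.fourierHat_sub (f g : SOmega ω d) :
    fourierHat ((f - g : SOmega ω d) : Euc d → ℂ) = fun t => fourierHat f t - fourierHat g t := by
  have h : fourierHat ((f + (-1 : ℂ) • g : SOmega ω d) : Euc d → ℂ) =
      fourierHat f + fourierHat ((-1 : ℂ) • (g : Euc d → ℂ)) :=
    fourierHat_add f.toSchwartz ((-1 : ℂ) • g).toSchwartz
  rw [fourierHat_smul] at h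
  rw [show f - g = f + (-1 : ℂ) • g by rw [neg_one_smul, sub_eq_add_neg], h]
  funext t
  simp [sub_eq_add_neg]

theorem SOmega.tendsto_nhds {X : Type*} {l : Filter X} {F : X → SOmega ω d} {f : SOmega ω d}
    (h : ∀ i, Tendsto (fun x => seminormFamily ω d i (F x - f)) l (𝓝 0)) :
    Tendsto F l (𝓝 f) := by
  rw [(withSeminorms ω d).tendsto_nhds']
  intro s ε hε
  filter_upwards [(Finset.eventually_all s).2 fun i _ => (h i).eventually (gt_mem_nhds hε)]
    with x hx using Seminorm.finset_sup_apply_lt hε hx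

theorem SOmega.tendsto_seminorm {X : Type*} {l : Filter X} {F : X → SOmega ω d} {f : SOmega ω d}
    (h : Tendsto F l (𝓝 f)) (i : (Set.Ioi (0 : ℝ) × ℕ) ⊕ (Set.Ioi (0 : ℝ) × ℕ)) :
    Tendsto (fun x => seminormFamily ω d i (F x - f)) l (𝓝 0) := by
  have hc := ((withSeminorms ω d).continuous_seminorm i).tendsto (f - f)
  have := hc.comp (h.sub_const f)
  simpa [Function.comp_def] using this

theorem tendsto_translate_zero (f : SOmega ω d) :
    Tendsto (fun y => translate y f) (𝓝 0) (𝓝 f) := by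
  refine SOmega.tendsto_nhds ?_
  rintro (i | i)
  · exact f.decay.tendsto_wsup_translate_sub f.smooth i.1.2 i.2
  · have h := (f.decay_hat.tendsto_wsup_modulate_sub f.smooth_hat i.1.2 i.2).comp
      (by simpa using (continuous_neg (G := Euc d)).tendsto 0)
    refine h.congr fun y => ?_
    change _ = wsup ω i.1 i.2 _
    rw [SOmega.fourierHat_sub, fourierHat_coe_translate]
    rfl

theorem tendsto_modulate_zero (f : SOmega ω d) :
    Tendsto (fun y => modulate y f) (𝓝 0) (𝓝 f) := by
  refine SOmega.tendsto_nhds ?_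
  rintro (i | i)
  · refine (f.decay.tendsto_wsup_modulate_sub f.smooth i.1.2 i.2).congr fun y => ?_
    change _ = wsup ω i.1 i.2 _
    rw [SOmega.coe_sub, coe_modulate]
  · refine (f.decay_hat.tendsto_wsup_translate_sub f.smooth_hat i.1.2 i.2).congr fun y => ?_
    change _ = wsup ω i.1 i.2 _
    rw [SOmega.fourierHat_sub, fourierHat_coe_modulate]

theorem seminormTime_translate_le (y : Euc d) (f : SOmega ω d) (i : Set.Ioi (0 : ℝ) × ℕ) :
    seminormTime ω d i (translate y f) ≤ Real.exp (i.1 * ω ‖y‖) * seminormTime ω d i f :=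
  f.decay.wsup_translate_le y i.1.2 i.2

theorem seminormTime_modulate_le (η : Euc d) (f : SOmega ω d) (i : Set.Ioi (0 : ℝ) × ℕ) :
    seminormTime ω d i (modulate η f) ≤ ∑ k ∈ Finset.range (i.2 + 1),
      ((i.2.choose k : ℝ) * ‖η‖ ^ k) * seminormTime ω d (i.1, i.2 - k) f := by
  change wsup ω i.1 i.2 _ ≤ _
  rw [coe_modulate]
  exact f.decay.wsup_modulate_le f.smooth η i.1.2 i.2

theorem seminormFreq_modulate_le (η : Euc d) (f : SOmega ω d) (i : Set.Ioi (0 : ℝ) × ℕ) :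
    seminormFreq ω d i (modulate η f) ≤ Real.exp (i.1 * ω ‖η‖) * seminormFreq ω d i f := by
  change wsup ω i.1 i.2 _ ≤ _
  rw [fourierHat_coe_modulate]
  exact f.decay_hat.wsup_translate_le η i.1.2 i.2

theorem seminormFreq_translate_le (y : Euc d) (f : SOmega ω d) (i : Set.Ioi (0 : ℝ) × ℕ) :
    seminormFreq ω d i (translate y f) ≤ ∑ k ∈ Finset.range (i.2 + 1),
      ((i.2.choose k : ℝ) * ‖y‖ ^ k) * seminormFreq ω d (i.1, i.2 - k) f := by
  change wsup ω i.1 i.2 _ ≤ _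
  rw [fourierHat_coe_translate, ← norm_neg y]
  exact f.decay_hat.wsup_modulate_le f.smooth_hat (-y) i.1.2 i.2

/-- Splits `M_ξ T_x f` as `M_ξ(T_x f - f) + M_ξ f`. The first term tends to `0` because the seminorm
bounds for `M_ξ` have coefficients that stay bounded near `ξ = 0`. -/
theorem tendsto_shift_zero (f : SOmega ω d) :
    Tendsto (fun z => shift z f) (𝓝 (0 : PhaseSpace d)) (𝓝 f) := by
  have hfst : Tendsto (fun z : PhaseSpace d => z.fst) (𝓝 0) (𝓝 0) :=
    (WithLp.prod_continuous_ofLp 2 _ _).fst.tendsto 0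
  have hsnd : Tendsto (fun z : PhaseSpace d => z.snd) (𝓝 0) (𝓝 0) :=
    (WithLp.prod_continuous_ofLp 2 _ _).snd.tendsto 0
  have h1 : Tendsto (fun z : PhaseSpace d => modulate z.snd f) (𝓝 0) (𝓝 f) :=
    (tendsto_modulate_zero f).comp hsnd
  have h2 : Tendsto (fun z : PhaseSpace d => modulate z.snd (translate z.fst f - f)) (𝓝 0)
      (𝓝 0) := by
    have ht : Tendsto (fun z : PhaseSpace d => translate z.fst f) (𝓝 0) (𝓝 f) :=
      (tendsto_translate_zero f).comp hfst
    refine SOmega.tendsto_nhds ?_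
    simp only [sub_zero]
    rintro (i | i)
    · refine squeeze_zero (fun z => apply_nonneg _ _)
        (fun z => seminormTime_modulate_le z.snd _ i) ?_
      have hs : Tendsto (fun z : PhaseSpace d => ∑ k ∈ Finset.range (i.2 + 1),
          ((i.2.choose k : ℝ) * ‖z.snd‖ ^ k) *
            seminormTime ω d (i.1, i.2 - k) (translate z.fst f - f)) (𝓝 0)
          (𝓝 (∑ k ∈ Finset.range (i.2 + 1),
            ((i.2.choose k : ℝ) * ‖(0 : Euc d)‖ ^ k) * 0)) :=
        tendsto_finsetSum _ fun k _ => ((hsnd.norm.pow k).const_mul _).mul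
          (SOmega.tendsto_seminorm ht (Sum.inl (i.1, i.2 - k)))
      simpa only [mul_zero, Finset.sum_const_zero] using hs
    · refine squeeze_zero (fun z => apply_nonneg _ _)
        (fun z => seminormFreq_modulate_le z.snd _ i) ?_
      have hw : Continuous fun η : Euc d => Real.exp (i.1 * ω ‖η‖) := by
        have := ω.continuous_norm (E := Euc d)
        fun_prop
      have hs := ((hw.tendsto 0).comp hsnd).mul (SOmega.tendsto_seminorm ht (Sum.inr i))
      rw [mul_zero] at hs
      exact hs
  have h := h2.add h1
  rw [zero_add] at h
  refine h.congr fun z => ?_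
  rw [map_sub, sub_add_cancel]
  rfl

theorem character_add_left (η ζ t : Euc d) :
    character (η + ζ) t = character η t * character ζ t := by
  unfold character
  rw [← Complex.exp_add, inner_add_right]
  push_cast
  ring_nf

theorem character_add_right (η s t : Euc d) :
    character η (s + t) = character η s * character η t := by
  unfold character
  rw [← Complex.exp_add, inner_add_left]
  push_cast
  ring_nf

theorem shift_apply' (z : PhaseSpace d) (f : SOmega ω d) (t : Euc d) :
    shift z f t = character z.snd t * f (t - z.fst) := shift_apply z f t

theorem SOmega.coe_smul (c : ℂ) (f : SOmega ω d) :
    ((c • f : SOmega ω d) : Euc d → ℂ) = c • (f : Euc d → ℂ) := rfl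

/-- The Heisenberg commutation relation; it reduces continuity of `z ↦ Π(z)f` at any point to
continuity at `0`. -/
theorem shift_add (z h : PhaseSpace d) (f : SOmega ω d) :
    shift (z + h) f = character h.snd z.fst • shift z (shift h f) := by
  refine SOmega.ext fun t => ?_
  rw [SOmega.coe_smul, Pi.smul_apply, smul_eq_mul, shift_apply', shift_apply', shift_apply']
  change character (z.snd + h.snd) t * f (t - (z.fst + h.fst)) = _
  rw [character_add_left, ← sub_sub]
  nth_rw 2 [show t = z.fst + (t - z.fst) by abel]
  rw [character_add_right]
  ring

theorem continuous_shift (f : SOmega ω d) : Continuous fun z : PhaseSpace d => shift z f := by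
  refine continuous_iff_continuousAt.2 fun z => ?_
  have hsnd : Continuous fun z : PhaseSpace d => z.snd := (WithLp.prod_continuous_ofLp 2 _ _).snd
  have hc : Continuous fun h : PhaseSpace d => character h.snd z.fst := by
    unfold character
    fun_prop
  have h := (hc.tendsto 0).smul (((shift z).continuous.tendsto f).comp (tendsto_shift_zero f))
  have h' : Tendsto (fun h => shift (z + h) f) (𝓝 0) (𝓝 (shift z f)) := by
    have e : character (0 : PhaseSpace d).snd z.fst • shift z f = shift z f := by
      simp [character]
    rw [← e]
    exact h.congr fun h => (shift_add z h f).symm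
  have h3 : Tendsto (fun w => w - z) (𝓝 z) (𝓝 0) := by
    simpa using (continuous_sub_right z).tendsto z
  refine (h'.comp h3).congr fun w => ?_
  simp

theorem wsup_comp_neg (g : Euc d → ℂ) (μ : ℝ) (n : ℕ) :
    wsup ω μ n (fun t => g (-t)) = wsup ω μ n g := by
  unfold wsup
  simp_rw [wnorm_neg]
  exact (Equiv.neg (Euc d)).iSup_comp (g := fun x => wnorm ω μ n g x)

theorem seminormFamily_conjFun (i : (Set.Ioi (0 : ℝ) × ℕ) ⊕ (Set.Ioi (0 : ℝ) × ℕ))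
    (f : SOmega ω d) : seminormFamily ω d i (conjFun f) = seminormFamily ω d i f := by
  rcases i with i | i
  · exact iSup_congr fun x => wnorm_conj f _ _ x
  · change wsup ω i.1 i.2 (fourierHat fun t => conj (f t)) = wsup ω i.1 i.2 (fourierHat f)
    rw [fourierHat_conj]
    refine Eq.trans (iSup_congr fun x => wnorm_conj (fun t => fourierHat f (-t)) _ _ x) ?_
    exact wsup_comp_neg _ _ _

theorem continuous_conjFun : Continuous (conjFun : SOmega ω d → SOmega ω d) := by
  refine continuous_iff_continuousAt.2 fun f => SOmega.tendsto_nhds fun i => ?_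
  have h := SOmega.tendsto_seminorm (F := id) (f := f) tendsto_id i
  refine h.congr fun g => ?_
  have e : conjFun g - conjFun f = conjFun (g - f) := SOmega.ext fun t => by
    change conj (g t) - conj (f t) = conj (g t - f t)
    rw [map_sub]
  rw [e]
  exact (seminormFamily_conjFun i _).symm

theorem exists_seminorm_shift_le (f : SOmega ω d)
    (i : (Set.Ioi (0 : ℝ) × ℕ) ⊕ (Set.Ioi (0 : ℝ) × ℕ)) :
    ∃ C M : ℝ, 0 ≤ C ∧ 0 ≤ M ∧ ∀ z : PhaseSpace d,
      seminormFamily ω d i (shift z f) ≤ C * Real.exp (M * ω ‖z‖) := by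
  -- The Leibniz rule for a character produces a polynomial of degree `n` in `t`, which `e^{nω(t)}`
  -- absorbs.
  have key : ∀ (n : ℕ) (a : ℕ → ℝ), (∀ k, 0 ≤ a k) → ∃ C : ℝ, 0 ≤ C ∧ ∀ t : ℝ, 0 ≤ t →
      ∑ k ∈ Finset.range (n + 1), ((n.choose k : ℝ) * t ^ k) * a k ≤ C * Real.exp (n * ω t) := by
    intro n a ha
    obtain ⟨C, hC, h⟩ := ω.exists_one_add_pow_le n
    have hA : 0 ≤ ∑ k ∈ Finset.range (n + 1), (n.choose k : ℝ) * a k :=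
      Finset.sum_nonneg fun k _ => mul_nonneg (by positivity) (ha k)
    refine ⟨(∑ k ∈ Finset.range (n + 1), (n.choose k : ℝ) * a k) * C, by positivity,
      fun t ht => ?_⟩
    rw [mul_assoc]
    refine le_trans ?_ (mul_le_mul_of_nonneg_left (h t ht) hA)
    rw [Finset.sum_mul]
    refine Finset.sum_le_sum fun k hk => ?_
    rw [mul_right_comm]
    refine mul_le_mul_of_nonneg_left ?_ (mul_nonneg (by positivity) (ha k))
    calc t ^ k ≤ (1 + t) ^ k := pow_le_pow_left₀ ht (by linarith) k
      _ ≤ _ := pow_le_pow_right₀ (by linarith) (Nat.lt_succ_iff.1 (Finset.mem_range.1 hk))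
  rcases i with i | i
  · obtain ⟨C, hC, h⟩ := key i.2 (fun k => seminormTime ω d (i.1, i.2 - k) f)
      fun k => apply_nonneg _ _
    have hi : (0 : ℝ) < i.1 := i.1.2
    refine ⟨C, i.2 + i.1, hC, by positivity, fun z => ?_⟩
    refine (seminormTime_modulate_le z.snd _ i).trans ?_
    calc _ ≤ ∑ k ∈ Finset.range (i.2 + 1), ((i.2.choose k : ℝ) * ‖z.snd‖ ^ k) *
          (Real.exp (i.1 * ω ‖z.fst‖) * seminormTime ω d (i.1, i.2 - k) f) := by
          refine Finset.sum_le_sum fun k _ => ?_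
          gcongr
          exact seminormTime_translate_le z.fst f (i.1, i.2 - k)
      _ = Real.exp (i.1 * ω ‖z.fst‖) * ∑ k ∈ Finset.range (i.2 + 1),
          ((i.2.choose k : ℝ) * ‖z.snd‖ ^ k) * seminormTime ω d (i.1, i.2 - k) f := by
          rw [Finset.mul_sum]
          exact Finset.sum_congr rfl fun k _ => by ring
      _ ≤ Real.exp (i.1 * ω ‖z‖) * (C * Real.exp (i.2 * ω ‖z‖)) := by
          gcongr
          · exact weight_fst_le ω z
          · refine (h _ (norm_nonneg _)).trans ?_
            gcongr
            exact weight_snd_le ω z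
      _ = _ := by rw [add_mul, Real.exp_add]; ring
  · obtain ⟨C, hC, h⟩ := key i.2 (fun k => seminormFreq ω d (i.1, i.2 - k) f)
      fun k => apply_nonneg _ _
    have hi : (0 : ℝ) < i.1 := i.1.2
    refine ⟨C, i.2 + i.1, hC, by positivity, fun z => ?_⟩
    refine (seminormFreq_modulate_le z.snd _ i).trans ?_
    calc _ ≤ Real.exp (i.1 * ω ‖z‖) * (C * Real.exp (i.2 * ω ‖z‖)) := by
          gcongr
          · exact weight_snd_le ω z
          · refine (seminormFreq_translate_le z.fst f i).trans ((h _ (norm_nonneg _)).trans ?_)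
            gcongr
            exact weight_fst_le ω z
      _ = _ := by rw [add_mul, Real.exp_add]; ring

end ShiftContinuity

/-! ### Decay of the kernel and the reproducing formula for functions -/

section Correlation

variable {d : ℕ} {ω : Weight}

open Filter Topology MeasureTheory

theorem RapidDecay.exists_norm_le {g : Euc d → ℂ} (hg : RapidDecay ω g) {μ : ℝ} (hμ : 0 < μ) :
    ∃ C : ℝ, 0 ≤ C ∧ ∀ x, ‖g x‖ ≤ C * Real.exp (-(μ * ω ‖x‖)) := by
  refine ⟨wsup ω μ 0 g, wsup_nonneg _ _ _ _, fun x => ?_⟩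
  have h := hg.le_wsup hμ 0 x
  rw [wnorm, norm_iteratedFDeriv_zero] at h
  rwa [Real.exp_neg, ← div_eq_mul_inv, le_div_iff₀ (Real.exp_pos _), mul_comm]

theorem SOmega.exists_norm_le (f : SOmega ω d) : ∃ C : ℝ, 0 ≤ C ∧ ∀ x, ‖f x‖ ≤ C := by
  obtain ⟨C, hC, h⟩ := f.decay.exists_norm_le one_pos
  refine ⟨C, hC, fun x => (h x).trans (mul_le_of_le_one_right hC ?_)⟩
  rw [Real.exp_le_one_iff]
  linarith [ω.norm_nonneg x]

theorem RapidDecay.exists_correlation_le {f g : Euc d → ℂ} (hf : RapidDecay ω f)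
    (hg : RapidDecay ω g) {μ : ℝ} (hμ : 0 < μ) :
    ∃ C : ℝ, 0 ≤ C ∧ ∀ x y : Euc d,
      ∫ s, ‖f (s - x)‖ * ‖g (s - y)‖ ≤ C * Real.exp (-(μ * ω ‖x - y‖)) := by
  -- The surplus rate `d + 1` makes the integral in `s` converge; the rate `μ` on both factors
  -- combines through `ω(x - y) ≤ ω(s - y) + ω(s - x)`.
  obtain ⟨A, hA, hA'⟩ := hf.exists_norm_le (μ := μ + (d + 1)) (by positivity)
  obtain ⟨B, hB, hB'⟩ := hg.exists_norm_le hμ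
  have hi := integrable_exp_weight ω d (μ := d + 1) le_rfl
  refine ⟨A * B * ∫ s : Euc d, Real.exp (-((d + 1) * ω ‖s‖)),
    mul_nonneg (by positivity) (integral_nonneg fun s => Real.exp_nonneg _), fun x y => ?_⟩
  rw [← integral_sub_right_eq_self (fun s : Euc d => Real.exp (-((d + 1) * ω ‖s‖))) x,
    mul_right_comm, ← integral_const_mul]
  refine integral_mono_of_nonneg (Eventually.of_forall fun s => by positivity)
    ((hi.comp_sub_right x).const_mul _) (Eventually.of_forall fun s => ?_)
  have hw := ω.norm_sub_le (s - y) (s - x)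
  rw [sub_sub_sub_cancel_left] at hw
  calc ‖f (s - x)‖ * ‖g (s - y)‖
      ≤ (A * Real.exp (-((μ + (d + 1)) * ω ‖s - x‖))) * (B * Real.exp (-(μ * ω ‖s - y‖))) := by
        gcongr
        · exact hA' _
        · exact hB' _
    _ = A * B * Real.exp (-(μ * (ω ‖s - y‖ + ω ‖s - x‖)) + -((d + 1) * ω ‖s - x‖)) := by
        rw [mul_mul_mul_comm, ← Real.exp_add]
        ring_nf
    _ ≤ A * B * Real.exp (-(μ * ω ‖x - y‖) + -((d + 1) * ω ‖s - x‖)) := by gcongr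
    _ = _ := by rw [Real.exp_add]; ring

theorem integral_comp_inv_two_pi_smul (H : Euc d → ℂ) :
    ∫ ξ, H ((2 * Real.pi)⁻¹ • ξ) = ((2 * Real.pi) ^ d : ℝ) * ∫ v, H v := by
  rw [Measure.integral_comp_smul, finrank_euclideanSpace_fin, inv_pow, inv_inv,
    abs_of_pos (by positivity), Complex.real_smul]

theorem integral_conj_fourierHat_mul (f g : 𝓢(Euc d, ℂ)) :
    ∫ ξ, conj (fourierHat f ξ) * fourierHat g ξ =
      ((2 * Real.pi) ^ d : ℝ) * ∫ x, conj (f x) * g x := by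
  have h := SchwartzMap.integral_inner_fourier_fourier f g
  simp only [RCLike.inner_apply'] at h
  rw [← h, ← integral_comp_inv_two_pi_smul]
  congr 1
  funext ξ
  rw [fourierHat_eq, fourierHat_eq]
  rfl

theorem integral_character_mul_fourierHat (f : 𝓢(Euc d, ℂ)) (t : Euc d) :
    ∫ ξ, character ξ t * fourierHat f ξ = ((2 * Real.pi) ^ d : ℝ) * f t := by
  have h : f t = 𝓕⁻ (𝓕 f) t := by rw [FourierTransform.fourierInv_fourier_eq]
  rw [h, SchwartzMap.fourierInv_coe, Real.fourierInv_eq, ← integral_comp_inv_two_pi_smul]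
  congr 1
  funext ξ
  rw [fourierHat_eq, Circle.smul_def, Real.fourierChar_apply, smul_eq_mul, inner_smul_left,
    character, SchwartzMap.fourier_coe, real_inner_comm]
  congr 2
  have : (Real.pi : ℂ) ≠ 0 := by exact_mod_cast Real.pi_ne_zero
  simp only [conj_trivial]
  push_cast
  field_simp

theorem norm_shift_apply (z : PhaseSpace d) (f : SOmega ω d) (t : Euc d) :
    ‖shift z f t‖ = ‖f (t - z.fst)‖ := by
  rw [shift_apply', norm_mul, norm_character, one_mul]

theorem norm_fourierHat_shift (z : PhaseSpace d) (f : SOmega ω d) (ξ : Euc d) :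
    ‖fourierHat (shift z f) ξ‖ = ‖fourierHat f (ξ - z.snd)‖ := by
  change ‖fourierHat (modulate z.snd (translate z.fst f)) ξ‖ = _
  rw [fourierHat_coe_modulate, fourierHat_coe_translate, norm_mul, norm_character, one_mul]

/-- The bilinear short-time Fourier coefficient `∫ f(s) (Π(z)ψ)(s) ds`. -/
def coef (f ψ : SOmega ω d) (z : PhaseSpace d) : ℂ := ∫ s, f s * shift z ψ s

/-- The modulus of the integral is bounded by a correlation of `φ` and `ψ`, which decays in the
difference of positions, and by Parseval also by a correlation of their Fourier transforms, which
decays in the difference of frequencies. The larger of the two weights is at least `ω(w - z) / 2`,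
hence the rate `2 * μ` on each side. -/
theorem exists_coef_conj_shift_le (φ ψ : SOmega ω d) {μ : ℝ} (hμ : 0 < μ) :
    ∃ C : ℝ, 0 ≤ C ∧ ∀ z w : PhaseSpace d,
      ‖coef (conjFun (shift z φ)) ψ w‖ ≤ C * Real.exp (-(μ * ω ‖w - z‖)) := by
  obtain ⟨A, hA, hA'⟩ := φ.decay.exists_correlation_le ψ.decay (μ := 2 * μ) (by positivity)
  obtain ⟨B, hB, hB'⟩ := φ.decay_hat.exists_correlation_le ψ.decay_hat (μ := 2 * μ) (by positivity)
  have hpi : 1 ≤ (2 * Real.pi) ^ d := one_le_pow₀ (by linarith [Real.two_le_pi])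
  refine ⟨A + B, by positivity, fun z w => ?_⟩
  have h1 : ‖coef (conjFun (shift z φ)) ψ w‖ ≤ A * Real.exp (-(2 * μ * ω ‖w.fst - z.fst‖)) := by
    rw [norm_sub_rev]
    refine (norm_integral_le_integral_norm _).trans (le_trans (le_of_eq ?_) (hA' z.fst w.fst))
    congr 1
    funext s
    rw [norm_mul, conjFun_apply, RCLike.norm_conj, norm_shift_apply, norm_shift_apply]
  have h2 : ‖coef (conjFun (shift z φ)) ψ w‖ ≤ B * Real.exp (-(2 * μ * ω ‖w.snd - z.snd‖)) := by
    rw [norm_sub_rev]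
    -- Parseval; its constant `(2π)^d` is at least `1` and can be dropped.
    have hp := integral_conj_fourierHat_mul (shift z φ).toSchwartz (shift w ψ).toSchwartz
    have hp' := congrArg norm hp
    rw [norm_mul, Complex.norm_real, Real.norm_of_nonneg (by positivity)] at hp'
    calc _ ≤ (2 * Real.pi) ^ d * ‖coef (conjFun (shift z φ)) ψ w‖ :=
          le_mul_of_one_le_left (norm_nonneg _) hpi
      _ = _ := hp'.symm
      _ ≤ _ := norm_integral_le_integral_norm _
      _ = ∫ s, ‖fourierHat φ (s - z.snd)‖ * ‖fourierHat ψ (s - w.snd)‖ := by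
          congr 1
          funext s
          rw [norm_mul, RCLike.norm_conj, norm_fourierHat_shift, norm_fourierHat_shift]
      _ ≤ _ := hB' z.snd w.snd
  have hw : ω ‖w - z‖ ≤ ω ‖w.fst - z.fst‖ + ω ‖w.snd - z.snd‖ := weight_le_fst_add_snd ω (w - z)
  rcases le_total (ω ‖w.fst - z.fst‖) (ω ‖w.snd - z.snd‖) with h | h
  · exact h2.trans (mul_le_mul (by linarith) (Real.exp_le_exp.2 (by nlinarith))
      (Real.exp_nonneg _) (by positivity))
  · exact h1.trans (mul_le_mul (by linarith) (Real.exp_le_exp.2 (by nlinarith))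
      (Real.exp_nonneg _) (by positivity))

theorem shift_zero (f : SOmega ω d) : shift 0 f = f := by
  refine SOmega.ext fun t => ?_
  rw [shift_apply']
  simp [character]

theorem conjFun_conjFun (f : SOmega ω d) : conjFun (conjFun f) = f :=
  SOmega.ext fun _ => Complex.conj_conj _

theorem exists_coef_le (f ψ : SOmega ω d) {μ : ℝ} (hμ : 0 < μ) :
    ∃ C : ℝ, 0 ≤ C ∧ ∀ w : PhaseSpace d, ‖coef f ψ w‖ ≤ C * Real.exp (-(μ * ω ‖w‖)) := by
  obtain ⟨C, hC, h⟩ := exists_coef_conj_shift_le (conjFun f) ψ hμ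
  refine ⟨C, hC, fun w => ?_⟩
  have := h 0 w
  rwa [shift_zero, conjFun_conjFun, sub_zero] at this

theorem SOmega.continuous (f : SOmega ω d) : Continuous (f : Euc d → ℂ) := f.smooth.continuous

theorem SOmega.integrable (f : SOmega ω d) : Integrable (f : Euc d → ℂ) :=
  f.toSchwartz.integrable

theorem continuous_shift_apply {X : Type*} [TopologicalSpace X] (f : SOmega ω d)
    {a : X → PhaseSpace d} {b : X → Euc d} (ha : Continuous a) (hb : Continuous b) :
    Continuous fun q => shift (a q) f (b q) := by
  simp only [shift_apply', character]
  have h1 : Continuous fun q => (a q).fst := (WithLp.prod_continuous_ofLp 2 _ _).fst.comp ha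
  have h2 : Continuous fun q => (a q).snd := (WithLp.prod_continuous_ofLp 2 _ _).snd.comp ha
  have hf := f.continuous
  fun_prop

theorem continuous_conjFun_shift_apply {X : Type*} [TopologicalSpace X] (f : SOmega ω d)
    {a : X → PhaseSpace d} {b : X → Euc d} (ha : Continuous a) (hb : Continuous b) :
    Continuous fun q => conjFun (shift (a q) f) (b q) := by
  have h := continuous_shift_apply f ha hb
  simp only [conjFun_apply]
  exact Complex.continuous_conj.comp h

theorem continuous_coef (f ψ : SOmega ω d) : Continuous (coef f ψ) := by
  obtain ⟨C, hC, h⟩ := ψ.exists_norm_le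
  refine continuous_of_dominated (bound := fun s => ‖f s‖ * C) (fun z => ?_) (fun z => ?_)
    (f.integrable.norm.mul_const C) (Eventually.of_forall fun s => ?_)
  · exact (f.continuous.mul (shift z ψ).continuous).aestronglyMeasurable
  · refine Eventually.of_forall fun s => ?_
    rw [norm_mul, norm_shift_apply]
    exact mul_le_mul_of_nonneg_left (h _) (norm_nonneg _)
  · exact continuous_const.mul (continuous_shift_apply ψ continuous_id continuous_const)

theorem continuous_coef_toPhase (f ψ : SOmega ω d) :
    Continuous fun p : Euc d × Euc d => coef f ψ (toPhase p) :=
  (continuous_coef f ψ).comp continuous_toPhase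

theorem integrable_coef_mul_of_le (f ψ : SOmega ω d) {G : Euc d × Euc d → ℝ} (hG : Continuous G)
    {C M : ℝ} (hM : 0 ≤ M)
    (h : ∀ p, |G p| ≤ C * Real.exp (M * ω ‖toPhase p‖)) :
    Integrable fun p : Euc d × Euc d => ‖coef f ψ (toPhase p)‖ * G p := by
  obtain ⟨A, hA, hA'⟩ := exists_coef_le f ψ (μ := M + 2 * (d + 1)) (by positivity)
  have hi := (integrable_exp_weight_phase ω d 0 (μ := 2 * (d + 1)) le_rfl).const_mul (A * C)
  have hm := (continuous_coef_toPhase f ψ).norm.mul hG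
  refine hi.mono' hm.aestronglyMeasurable (Eventually.of_forall fun p => ?_)
  rw [norm_mul, norm_norm, Real.norm_eq_abs, sub_zero]
  calc _ ≤ (A * Real.exp (-((M + 2 * (d + 1)) * ω ‖toPhase p‖))) *
        (C * Real.exp (M * ω ‖toPhase p‖)) := by
        gcongr
        · exact hA' _
        · exact h p
    _ = _ := by
        rw [mul_mul_mul_comm, ← Real.exp_add]
        ring_nf

theorem integrable_coef (f ψ : SOmega ω d) :
    Integrable fun p : Euc d × Euc d => coef f ψ (toPhase p) := by
  have h := integrable_coef_mul_of_le f ψ (G := fun _ => 1) continuous_const le_rfl (C := 1)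
    (fun p => by simp)
  refine h.mono' (continuous_coef_toPhase f ψ).aestronglyMeasurable
    (Eventually.of_forall fun p => by simp)

/-- The constant `(2π)^d ∫ |ψ|²` of the reproducing formula. -/
def reproConst (ψ : SOmega ω d) : ℝ := (2 * Real.pi) ^ d * ∫ x, ‖ψ x‖ ^ 2

theorem reproConst_ne_zero {ψ : SOmega ω d} (hψ : ψ ≠ 0) : reproConst ψ ≠ 0 := by
  obtain ⟨x, hx⟩ : ∃ x, ψ x ≠ 0 := by
    by_contra! h
    exact hψ (SOmega.ext h)
  obtain ⟨C, hC, h⟩ := ψ.exists_norm_le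
  have hi : Integrable fun x => ‖ψ x‖ ^ 2 := by
    refine (ψ.integrable.norm.mul_const C).mono' (ψ.continuous.norm.pow 2).aestronglyMeasurable
      (Eventually.of_forall fun x => ?_)
    rw [Real.norm_of_nonneg (by positivity), sq]
    exact mul_le_mul_of_nonneg_left (h x) (norm_nonneg _)
  have := integral_pos_of_integrable_nonneg_nonzero (ψ.continuous.norm.pow 2) hi
    (fun x => sq_nonneg _) (x := x) (by simpa using hx)
  have hpi : 0 < (2 * Real.pi) ^ d := by positivity
  exact (mul_pos hpi this).ne'

/-- For fixed `x` the coefficient is, up to the sign of `ξ`, the Fourier transform of `s ↦ f(s) ψ(s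
- x)`. Inversion in `ξ` returns `f(t) ψ(t - x)`, and integrating against `conj ψ(t - x)` over `x`
leaves `f(t) ‖ψ‖²`. -/
theorem integral_coef_mul_conj_shift (f ψ : SOmega ω d) (t : Euc d) :
    ∫ p : Euc d × Euc d, coef f ψ (toPhase p) * conjFun (shift (toPhase p) ψ) t =
      reproConst ψ * f t := by
  obtain ⟨C, hC, hC'⟩ := ψ.exists_norm_le
  have hcont : Continuous fun p : Euc d × Euc d => conjFun (shift (toPhase p) ψ) t :=
    continuous_conjFun_shift_apply ψ continuous_toPhase continuous_const
  have hint : Integrable fun p : Euc d × Euc d =>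
      coef f ψ (toPhase p) * conjFun (shift (toPhase p) ψ) t := by
    refine (integrable_coef f ψ).mul_bdd (c := C) hcont.aestronglyMeasurable
      (Eventually.of_forall fun p => ?_)
    rw [conjFun_apply, RCLike.norm_conj, norm_shift_apply]
    exact hC' _
  rw [Measure.volume_eq_prod, integral_prod _ hint]
  have inner : ∀ x : Euc d, ∫ ξ : Euc d, coef f ψ (toPhase (x, ξ)) *
      conjFun (shift (toPhase (x, ξ)) ψ) t =
      ((2 * Real.pi) ^ d : ℝ) * f t * ((‖ψ (t - x)‖ ^ 2 : ℝ) : ℂ) := by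
    intro x
    let F : 𝓢(Euc d, ℂ) := SchwartzMap.smulLeftCLM ℂ (f : Euc d → ℂ) (translate x ψ).toSchwartz
    have hF : ∀ s, F s = f s * ψ (s - x) := fun s => by
      change SchwartzMap.smulLeftCLM ℂ (f : Euc d → ℂ) (translate x ψ).toSchwartz s = _
      rw [SchwartzMap.smulLeftCLM_apply_apply f.toSchwartz.hasTemperateGrowth, smul_eq_mul]
      rfl
    have hc : ∀ ξ, coef f ψ (toPhase (x, ξ)) = fourierHat F (-ξ) := fun ξ => by
      unfold coef fourierHat
      congr 1
      funext s
      rw [hF, shift_apply, inner_neg_right]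
      simp only [toPhase_snd, toPhase_fst, Complex.ofReal_neg, mul_neg, neg_neg]
      ring
    have hch : ∀ ξ, conj (character ξ t) = character (-ξ) t := fun ξ => by
      unfold character
      rw [← Complex.exp_conj]
      simp
    calc _ = ∫ ξ, (character (-ξ) t * fourierHat F (-ξ)) * conj (ψ (t - x)) := by
          congr 1
          funext ξ
          rw [hc, conjFun_apply, shift_apply', map_mul, toPhase_snd, hch]
          simp only [toPhase_fst]
          ring
      _ = _ := by
          rw [integral_mul_const,
            integral_neg_eq_self (fun ξ => character ξ t * fourierHat F ξ) volume,
            integral_character_mul_fourierHat, hF, mul_assoc, mul_assoc, mul_assoc,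
            Complex.mul_conj']
          push_cast
          rfl
  simp_rw [inner]
  rw [integral_const_mul, integral_complex_ofReal, integral_sub_left_eq_self
    (fun x => ‖ψ x‖ ^ 2) volume t, reproConst]
  push_cast
  ring

/-- Fubini applied to the pointwise formula: the integrand has modulus `|coef| |ψ(t - x)|`, whose
integral over `t` is `|coef|` times the `L¹` norm of `ψ`. -/
theorem integral_coef_mul_fourierHat (f ψ : SOmega ω d) (η : Euc d) :
    ∫ p : Euc d × Euc d, coef f ψ (toPhase p) * fourierHat (conjFun (shift (toPhase p) ψ)) η =
      reproConst ψ * fourierHat f η := by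
  have hcont : Continuous fun q : (Euc d × Euc d) × Euc d =>
      Complex.exp (-(Complex.I * ((inner ℝ q.2 η : ℝ) : ℂ))) *
        (coef f ψ (toPhase q.1) * conjFun (shift (toPhase q.1) ψ) q.2) := by
    have h3 : Continuous fun q : (Euc d × Euc d) × Euc d => coef f ψ (toPhase q.1) :=
      (continuous_coef_toPhase f ψ).comp continuous_fst
    exact (Continuous.cexp (by fun_prop)).mul (h3.mul
      (continuous_conjFun_shift_apply ψ (continuous_toPhase.comp continuous_fst) continuous_snd))
  have hnorm : ∀ (t : Euc d) (p : Euc d × Euc d),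
      ‖Complex.exp (-(Complex.I * ((inner ℝ t η : ℝ) : ℂ))) *
        (coef f ψ (toPhase p) * conjFun (shift (toPhase p) ψ) t)‖ =
        ‖coef f ψ (toPhase p)‖ * ‖ψ (t - p.1)‖ := fun t p => by
    rw [norm_mul, norm_mul, conjFun_apply, RCLike.norm_conj, norm_shift_apply, mul_comm Complex.I,
      ← neg_mul, ← Complex.ofReal_neg, Complex.norm_exp_ofReal_mul_I, one_mul]
    rfl
  have hint : Integrable (Function.uncurry fun (p : Euc d × Euc d) (t : Euc d) =>
      Complex.exp (-(Complex.I * ((inner ℝ t η : ℝ) : ℂ))) *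
        (coef f ψ (toPhase p) * conjFun (shift (toPhase p) ψ) t)) (volume.prod volume) := by
    refine (integrable_prod_iff hcont.aestronglyMeasurable).2 ?_
    refine ⟨Eventually.of_forall fun p => ?_, ?_⟩
    · refine ((ψ.integrable.comp_sub_right p.1).norm.const_mul ‖coef f ψ (toPhase p)‖).mono'
        (hcont.comp (continuous_const.prodMk continuous_id)).aestronglyMeasurable
        (Eventually.of_forall fun t => (hnorm t p).le)
    · simp only [hnorm, integral_const_mul]
      simp_rw [fun p : Euc d × Euc d =>
        integral_sub_right_eq_self (μ := (volume : Measure (Euc d))) (fun t => ‖ψ t‖) p.1]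
      exact (integrable_coef f ψ).norm.mul_const _
  calc _ = ∫ p : Euc d × Euc d, ∫ t, Complex.exp (-(Complex.I * ((inner ℝ t η : ℝ) : ℂ))) *
        (coef f ψ (toPhase p) * conjFun (shift (toPhase p) ψ) t) := by
        congr 1
        funext p
        unfold fourierHat
        rw [← integral_const_mul]
        congr 1
        funext t
        ring
    _ = ∫ t, ∫ p : Euc d × Euc d, Complex.exp (-(Complex.I * ((inner ℝ t η : ℝ) : ℂ))) *
        (coef f ψ (toPhase p) * conjFun (shift (toPhase p) ψ) t) := integral_integral_swap hint
    _ = _ := by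
        simp_rw [integral_const_mul, integral_coef_mul_conj_shift]
        unfold fourierHat
        rw [← integral_const_mul]
        congr 1
        funext t
        ring

/-- Induction on the order, differentiating once under the integral with the dominating function of
the next order; currying identifies the derivative of the `n`-th derivative with the derivative of
order `n + 1`. -/
theorem iteratedFDeriv_integral {α E F : Type*} [MeasurableSpace α] {ν : Measure α}
    [NormedAddCommGroup E] [NormedSpace ℝ E] [NormedAddCommGroup F] [NormedSpace ℝ F]
    [CompleteSpace F] {h : α → E → F} {H : E → F} (hs : ∀ a, ContDiff ℝ (⊤ : ℕ∞) (h a))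
    (hmeas : ∀ n x, AEStronglyMeasurable (fun a => iteratedFDeriv ℝ n (h a) x) ν)
    {bound : ℕ → α → ℝ} (hbound : ∀ n, Integrable (bound n) ν)
    (hle : ∀ n a x, ‖iteratedFDeriv ℝ n (h a) x‖ ≤ bound n a)
    (hH : ∀ x, ∫ a, h a x ∂ν = H x) (n : ℕ) (x : E) :
    ∫ a, iteratedFDeriv ℝ n (h a) x ∂ν = iteratedFDeriv ℝ n H x := by
  have hint : ∀ n x, Integrable (fun a => iteratedFDeriv ℝ n (h a) x) ν := fun n x =>
    (hbound n).mono' (hmeas n x) (Eventually.of_forall fun a => hle n a x)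
  induction n generalizing x with
  | zero =>
    let L := (continuousMultilinearCurryFin0 ℝ E F).symm.toContinuousLinearEquiv
    have e : ∀ g : E → F, iteratedFDeriv ℝ 0 g x = L (g x) := fun g => rfl
    simp only [e]
    rw [ContinuousLinearEquiv.integral_comp_comm, hH]
  | succ n ih =>
    let L := (continuousMultilinearCurryLeftEquiv ℝ (fun _ : Fin (n + 1) => E)
      F).symm.toContinuousLinearEquiv
    have e : ∀ g : E → F, iteratedFDeriv ℝ (n + 1) g x = L (fderiv ℝ (iteratedFDeriv ℝ n g) x) :=
      fun g => rfl
    have e' : ∀ g : E → F, fderiv ℝ (iteratedFDeriv ℝ n g) x =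
        L.symm (iteratedFDeriv ℝ (n + 1) g x) := fun g => by
      rw [e, ContinuousLinearEquiv.symm_apply_apply]
    have hd : HasFDerivAt (fun y => ∫ a, iteratedFDeriv ℝ n (h a) y ∂ν)
        (∫ a, fderiv ℝ (iteratedFDeriv ℝ n (h a)) x ∂ν) x := by
      refine hasFDerivAt_integral_of_dominated_of_fderiv_le Filter.univ_mem
        (Eventually.of_forall fun y => hmeas n y) (hint n x)
        (F' := fun y a => fderiv ℝ (iteratedFDeriv ℝ n (h a)) y) ?_
        (Eventually.of_forall fun a y _ => ?_) (hbound (n + 1))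
        (Eventually.of_forall fun a y _ => ?_)
      · simp only [e']
        exact L.symm.continuous.comp_aestronglyMeasurable (hmeas (n + 1) x)
      · rw [norm_fderiv_iteratedFDeriv]
        exact hle _ _ _
      · exact (((hs a).of_le (by exact_mod_cast le_top : ((n + 1 : ℕ) : WithTop ℕ∞) ≤ _)
          ).differentiable_iteratedFDeriv
          (by exact_mod_cast n.lt_succ_self)).differentiableAt.hasFDerivAt
    have hfun : (fun y => ∫ a, iteratedFDeriv ℝ n (h a) y ∂ν) = iteratedFDeriv ℝ n H :=
      funext ih
    rw [hfun] at hd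
    rw [e, hd.fderiv]
    exact ContinuousLinearEquiv.integral_comp_comm (𝕜 := ℝ) (E := E →L[ℝ] E [×n]→L[ℝ] F)
      (F := E [×(n + 1)]→L[ℝ] F) (μ := ν) L fun a => fderiv ℝ (iteratedFDeriv ℝ n (h a)) x

end Correlation

/-! ### The reproducing formula for distributions -/

section Reproducing

variable {d : ℕ} {ω : Weight}

open Filter Topology MeasureTheory BoundedContinuousFunction

/-- The function `f` itself, or its Fourier transform. -/
def transform (ω : Weight) (d : ℕ) : Bool → SOmega ω d →ₗ[ℂ] (Euc d → ℂ)
  | true =>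
    { toFun := fun f => f
      map_add' := fun _ _ => rfl
      map_smul' := fun _ _ => rfl }
  | false =>
    { toFun := fun f => fourierHat f
      map_add' := fun f g => fourierHat_add f.toSchwartz g.toSchwartz
      map_smul' := fun c f => fourierHat_smul c f }

theorem contDiff_transform (b : Bool) (f : SOmega ω d) :
    ContDiff ℝ (⊤ : ℕ∞) (transform ω d b f) := by
  cases b
  exacts [f.smooth_hat, f.smooth]

theorem rapidDecay_transform (b : Bool) (f : SOmega ω d) : RapidDecay ω (transform ω d b f) := by
  cases b
  exacts [f.decay_hat, f.decay]

theorem integral_coef_mul_transform (b : Bool) (f ψ : SOmega ω d) (x : Euc d) :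
    ∫ p : Euc d × Euc d, coef f ψ (toPhase p) *
      transform ω d b (conjFun (shift (toPhase p) ψ)) x = reproConst ψ * transform ω d b f x := by
  cases b
  exacts [integral_coef_mul_fourierHat f ψ x, integral_coef_mul_conj_shift f ψ x]

/-- The seminorm index belonging to `f` (for `true`) or its Fourier transform (for `false`). -/
def sideIndex : Bool → Set.Ioi (0 : ℝ) × ℕ → (Set.Ioi (0 : ℝ) × ℕ) ⊕ (Set.Ioi (0 : ℝ) × ℕ)
  | true => Sum.inl
  | false => Sum.inr

theorem seminormFamily_sideIndex (b : Bool) (j : Set.Ioi (0 : ℝ) × ℕ) (f : SOmega ω d) :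
    seminormFamily ω d (sideIndex b j) f = wsup ω j.1 j.2 (transform ω d b f) := by
  cases b <;> rfl

theorem sideIndex_isLeft_elim (i : (Set.Ioi (0 : ℝ) × ℕ) ⊕ (Set.Ioi (0 : ℝ) × ℕ)) :
    sideIndex i.isLeft (Sum.elim id id i) = i := by
  cases i <;> rfl

/-- The Banach space of bounded continuous functions with values in a normed space. -/
abbrev BddCont (d : ℕ) (F : Type*) [NormedAddCommGroup F] : Type _ := Euc d →ᵇ F

/-- The bounded continuous function `e^{μ ω} ∂^n g`, where `g` is `f` or its Fourier transform. -/
def weightedDeriv (ω : Weight) (d : ℕ) (b : Bool) (j : Set.Ioi (0 : ℝ) × ℕ) :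
    SOmega ω d →ₗ[ℂ] BddCont d (Euc d [×j.2]→L[ℝ] ℂ) where
  toFun f := BoundedContinuousFunction.ofNormedAddCommGroup
    (fun x => Real.exp (j.1 * ω ‖x‖) • iteratedFDeriv ℝ j.2 (transform ω d b f) x)
    ((Real.continuous_exp.comp (continuous_const.mul ω.continuous_norm)).smul
      ((contDiff_nat (contDiff_transform b f) j.2).continuous_iteratedFDeriv le_rfl))
    (wsup ω j.1 j.2 (transform ω d b f))
    (fun x => by
      rw [norm_smul, Real.norm_of_nonneg (Real.exp_nonneg _)]
      exact (rapidDecay_transform b f).le_wsup j.1.2 j.2 x)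
  map_add' f g := by
    ext1 x
    simp only [BoundedContinuousFunction.coe_ofNormedAddCommGroup,
      BoundedContinuousFunction.coe_add, Pi.add_apply, map_add]
    rw [iteratedFDeriv_add_apply (contDiff_nat (contDiff_transform b f) _).contDiffAt
      (contDiff_nat (contDiff_transform b g) _).contDiffAt, smul_add]
  map_smul' c f := by
    ext1 x
    simp only [BoundedContinuousFunction.coe_ofNormedAddCommGroup,
      BoundedContinuousFunction.coe_smul, map_smul, RingHom.id_apply]
    rw [iteratedFDeriv_const_smul_apply (contDiff_nat (contDiff_transform b f) _).contDiffAt,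
      smul_comm]

theorem weightedDeriv_apply (b : Bool) (j : Set.Ioi (0 : ℝ) × ℕ) (f : SOmega ω d) (x : Euc d) :
    weightedDeriv ω d b j f x =
      Real.exp (j.1 * ω ‖x‖) • iteratedFDeriv ℝ j.2 (transform ω d b f) x := rfl

theorem norm_weightedDeriv_apply (b : Bool) (j : Set.Ioi (0 : ℝ) × ℕ) (f : SOmega ω d)
    (x : Euc d) : ‖weightedDeriv ω d b j f x‖ = wnorm ω j.1 j.2 (transform ω d b f) x := by
  rw [weightedDeriv_apply, norm_smul, Real.norm_of_nonneg (Real.exp_nonneg _), wnorm]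

/-- This turns each defining seminorm of `S_ω` into the norm of a Banach space, so that Bochner
integration becomes available. -/
theorem norm_weightedDeriv (b : Bool) (j : Set.Ioi (0 : ℝ) × ℕ) (f : SOmega ω d) :
    ‖weightedDeriv ω d b j f‖ = seminormFamily ω d (sideIndex b j) f := by
  rw [seminormFamily_sideIndex]
  refine le_antisymm ((BoundedContinuousFunction.norm_le (wsup_nonneg _ _ _ _)).2 fun x => ?_)
    (wsup_le fun x => ?_)
  · rw [norm_weightedDeriv_apply]
    exact (rapidDecay_transform b f).le_wsup j.1.2 j.2 x
  · rw [← norm_weightedDeriv_apply]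
    exact (weightedDeriv ω d b j f).norm_coe_le_norm x

theorem continuous_weightedDeriv (b : Bool) (j : Set.Ioi (0 : ℝ) × ℕ) :
    Continuous (weightedDeriv ω d b j) := by
  refine continuous_iff_continuousAt.2 fun f => ?_
  refine tendsto_iff_dist_tendsto_zero.2 ?_
  refine (SOmega.tendsto_seminorm (tendsto_id (x := 𝓝 f)) (sideIndex b j)).congr fun g => ?_
  rw [dist_eq_norm, ← norm_weightedDeriv, map_sub, id]

theorem continuous_iteratedFDeriv_transform (b : Bool) (n : ℕ) (x : Euc d) :
    Continuous fun f : SOmega ω d => iteratedFDeriv ℝ n (transform ω d b f) x := by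
  have h := ((BoundedContinuousFunction.evalCLM ℂ (β := Euc d [×n]→L[ℝ] ℂ) x).continuous.comp
    (continuous_weightedDeriv (ω := ω) b (⟨1, Set.mem_Ioi.2 one_pos⟩, n))).const_smul
    (Real.exp (1 * ω ‖x‖))⁻¹
  refine h.congr fun f => ?_
  change (Real.exp (1 * ω ‖x‖))⁻¹ • (Real.exp (1 * ω ‖x‖) •
    iteratedFDeriv ℝ n (transform ω d b f) x) = _
  rw [smul_smul, inv_mul_cancel₀ (Real.exp_pos _).ne', one_smul]

theorem continuous_conjFun_shift (ψ : SOmega ω d) :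
    Continuous fun p : Euc d × Euc d => conjFun (shift (toPhase p) ψ) :=
  continuous_conjFun.comp ((continuous_shift ψ).comp continuous_toPhase)

theorem integrable_coef_mul_seminorm (f ψ : SOmega ω d)
    (i : (Set.Ioi (0 : ℝ) × ℕ) ⊕ (Set.Ioi (0 : ℝ) × ℕ)) :
    Integrable fun p : Euc d × Euc d =>
      ‖coef f ψ (toPhase p)‖ * seminormFamily ω d i (conjFun (shift (toPhase p) ψ)) := by
  obtain ⟨C, M, hC, hM, h⟩ := exists_seminorm_shift_le ψ i
  refine integrable_coef_mul_of_le f ψ (C := C) (((withSeminorms ω d).continuous_seminorm i).comp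
    (continuous_conjFun_shift ψ)) hM fun p => ?_
  rw [abs_of_nonneg (apply_nonneg _ _), seminormFamily_conjFun]
  exact h _

theorem integral_coef_smul_iteratedFDeriv (b : Bool) (f ψ : SOmega ω d) (n : ℕ) (x : Euc d) :
    ∫ p : Euc d × Euc d, coef f ψ (toPhase p) •
      iteratedFDeriv ℝ n (transform ω d b (conjFun (shift (toPhase p) ψ))) x =
      (reproConst ψ : ℂ) • iteratedFDeriv ℝ n (transform ω d b f) x := by
  have hsm : ∀ (c : ℂ) (g : SOmega ω d) (n : ℕ) (x : Euc d),
      iteratedFDeriv ℝ n (c • transform ω d b g) x =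
        c • iteratedFDeriv ℝ n (transform ω d b g) x := fun c g n x =>
    iteratedFDeriv_const_smul_apply (contDiff_nat (contDiff_transform b g) n).contDiffAt
  rw [← hsm]
  simp only [← hsm]
  refine iteratedFDeriv_integral
    (h := fun p : Euc d × Euc d => coef f ψ (toPhase p) •
      transform ω d b (conjFun (shift (toPhase p) ψ)))
    (fun p => (contDiff_transform b (conjFun (shift (toPhase p) ψ))).const_smul
      (coef f ψ (toPhase p))) (fun n x => ?_)
    -- Any positive rate would do: as `e^ω ≥ 1`, the weighted seminorm dominates the unweighted
    -- derivative uniformly in `x`.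
    (bound := fun n p => ‖coef f ψ (toPhase p)‖ *
      seminormFamily ω d (sideIndex b (⟨1, Set.mem_Ioi.2 one_pos⟩, n)) (conjFun (shift (toPhase p) ψ)))
    (fun n => integrable_coef_mul_seminorm f ψ (sideIndex b (⟨1, Set.mem_Ioi.2 one_pos⟩, n)))
    (fun n p x => ?_)
    (fun x => integral_coef_mul_transform b f ψ x) n x
  · simp only [hsm]
    exact ((continuous_coef_toPhase f ψ).smul ((continuous_iteratedFDeriv_transform b n x).comp
      (continuous_conjFun_shift ψ))).aestronglyMeasurable
  · rw [hsm, norm_smul, seminormFamily_sideIndex]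
    refine mul_le_mul_of_nonneg_left (le_trans ?_ ((rapidDecay_transform b _).le_wsup one_pos n x))
      (norm_nonneg _)
    refine le_mul_of_one_le_left (norm_nonneg _) (Real.one_le_exp ?_)
    rw [one_mul]
    exact ω.norm_nonneg x

/-- A linear functional that is bounded with respect to the norm pulled back along a linear map
factors through a bounded linear functional. -/
theorem exists_dual_factor {E B : Type*} [AddCommGroup E] [Module ℂ E] [NormedAddCommGroup B]
    [NormedSpace ℂ B] (J : E →ₗ[ℂ] B) (u : E →ₗ[ℂ] ℂ) (C : ℝ) (h : ∀ f, ‖u f‖ ≤ C * ‖J f‖) :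
    ∃ v : B →L[ℂ] ℂ, ∀ f, v (J f) = u f := by
  have hk : LinearMap.ker J ≤ LinearMap.ker u := fun f hf => by
    rw [LinearMap.mem_ker] at hf ⊢
    have := h f
    rw [hf, norm_zero, mul_zero] at this
    exact norm_le_zero_iff.1 this
  let g : LinearMap.range J →ₗ[ℂ] ℂ :=
    ((LinearMap.ker J).liftQ u hk).comp J.quotKerEquivRange.symm.toLinearMap
  have hg : ∀ f, g ⟨J f, LinearMap.mem_range_self J f⟩ = u f := fun f => by
    have e : J.quotKerEquivRange.symm ⟨J f, LinearMap.mem_range_self J f⟩ =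
        (LinearMap.ker J).mkQ f := J.quotKerEquivRange_symm_apply_image f _
    change (LinearMap.ker J).liftQ u hk (J.quotKerEquivRange.symm _) = u f
    rw [e]
    rfl
  -- Hahn–Banach: the functional induced on the range of `J` is bounded by `C`.
  obtain ⟨v, hv, -⟩ := exists_extension_norm_eq (LinearMap.range J) (g.mkContinuous C (by
    rintro ⟨_, f, rfl⟩
    rw [hg]
    exact h f))
  exact ⟨v, fun f => (hv ⟨J f, LinearMap.mem_range_self J f⟩).trans (hg f)⟩

/-- A linear functional bounded by finitely many norms, each pulled back along a linear map, commutes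
with integrals that converge with respect to these norms. -/
theorem integral_mul_apply_eq {E ι α : Type*} [AddCommGroup E] [Module ℂ E] [Fintype ι]
    {B : ι → Type*} [∀ i, NormedAddCommGroup (B i)] [∀ i, NormedSpace ℂ (B i)]
    [∀ i, CompleteSpace (B i)] (J : ∀ i, E →ₗ[ℂ] B i) (u : E →ₗ[ℂ] ℂ) (C : ℝ)
    (h : ∀ f, ‖u f‖ ≤ C * ‖fun i => J i f‖) [MeasurableSpace α] {ν : Measure α} (A : α → E)
    (c : α → ℂ) (hint : ∀ i, Integrable (fun a => c a • J i (A a)) ν) (f : E)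
    (hf : ∀ i, ∫ a, c a • J i (A a) ∂ν = J i f) : ∫ a, c a * u (A a) ∂ν = u f := by
  obtain ⟨v, hv⟩ := exists_dual_factor (LinearMap.pi J) u C h
  have hi : Integrable (fun a => c a • LinearMap.pi J (A a)) ν := Integrable.of_eval hint
  have key : ∫ a, c a • LinearMap.pi J (A a) ∂ν = LinearMap.pi J f :=
    funext fun i => (eval_integral hint i).trans (hf i)
  have e := v.integral_comp_comm hi
  rw [key, hv] at e
  simpa only [map_smul, hv, smul_eq_mul] using e

theorem integrable_coef_smul_weightedDeriv (f ψ : SOmega ω d) (b : Bool)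
    (j : Set.Ioi (0 : ℝ) × ℕ) :
    Integrable fun p : Euc d × Euc d =>
      coef f ψ (toPhase p) • weightedDeriv ω d b j (conjFun (shift (toPhase p) ψ)) := by
  have hc : Continuous fun p : Euc d × Euc d =>
      coef f ψ (toPhase p) • weightedDeriv ω d b j (conjFun (shift (toPhase p) ψ)) :=
    (continuous_coef_toPhase f ψ).smul
      ((continuous_weightedDeriv b j).comp (continuous_conjFun_shift ψ))
  refine (integrable_coef_mul_seminorm f ψ (sideIndex b j)).mono' hc.aestronglyMeasurable
    (Eventually.of_forall fun p => ?_)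
  rw [norm_smul, norm_weightedDeriv]

/-- Evaluation at a point is bounded on the Banach space, so the Bochner integral is identified
pointwise, where the formula is the differentiated reproducing identity. -/
theorem integral_coef_smul_weightedDeriv (f ψ : SOmega ω d) (b : Bool)
    (j : Set.Ioi (0 : ℝ) × ℕ) :
    ∫ p : Euc d × Euc d,
      coef f ψ (toPhase p) • weightedDeriv ω d b j (conjFun (shift (toPhase p) ψ)) =
      weightedDeriv ω d b j ((reproConst ψ : ℂ) • f) := by
  ext1 x
  have e := (BoundedContinuousFunction.evalCLM ℂ (β := Euc d [×j.2]→L[ℝ] ℂ) x).integral_comp_comm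
    (integrable_coef_smul_weightedDeriv f ψ b j)
  refine e.symm.trans ?_
  rw [map_smul]
  change ∫ p : Euc d × Euc d, coef f ψ (toPhase p) • (Real.exp (j.1 * ω ‖x‖) •
      iteratedFDeriv ℝ j.2 (transform ω d b (conjFun (shift (toPhase p) ψ))) x) =
    (reproConst ψ : ℂ) • (Real.exp (j.1 * ω ‖x‖) • iteratedFDeriv ℝ j.2 (transform ω d b f) x)
  simp_rw [smul_comm _ (Real.exp (j.1 * ω ‖x‖))]
  rw [integral_smul, integral_coef_smul_iteratedFDeriv]

/-- The reproducing formula `(2π)^d ‖ψ‖² u(f) = ∫ (∫ f(s) (Π(z)ψ)(s) ds) V_ψ u(z) dz`. -/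
theorem integral_coef_mul_stft (u : SOmegaDual ω d) (f ψ : SOmega ω d) :
    ∫ p : Euc d × Euc d, coef f ψ (toPhase p) * stft ψ u (toPhase p) = reproConst ψ * u f := by
  -- The finite set `s` of seminorms controlling `u` indexes the product of Banach spaces through
  -- which `u` factors.
  obtain ⟨s, C, -, hs⟩ := Seminorm.bound_of_continuous (withSeminorms ω d)
    ((normSeminorm ℂ ℂ).comp u.toLinearMap) (continuous_norm.comp u.continuous)
  have h := integral_mul_apply_eq
    (fun i : s => weightedDeriv ω d i.1.isLeft (Sum.elim id id i.1)) u.toLinearMap C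
    (fun g => ?_) (fun p : Euc d × Euc d => conjFun (shift (toPhase p) ψ))
    (fun p => coef f ψ (toPhase p))
    (fun i => integrable_coef_smul_weightedDeriv f ψ _ _) ((reproConst ψ : ℂ) • f)
    (fun i => integral_coef_smul_weightedDeriv f ψ _ _)
  · rw [map_smul] at h
    exact h
  · refine (hs g).trans (mul_le_mul_of_nonneg_left ?_ C.2)
    refine Seminorm.finset_sup_apply_le (norm_nonneg _) fun i hi => ?_
    rw [← sideIndex_isLeft_elim i, ← norm_weightedDeriv]
    exact norm_le_pi_norm
      (fun i : s => weightedDeriv ω d i.1.isLeft (Sum.elim id id i.1) g) ⟨i, hi⟩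

end Reproducing

/-! ### Change of window and decay in cones -/

section WindowChange

variable {d : ℕ} {ω : Weight}

open Filter Topology MeasureTheory

/-- A continuous functional is bounded by finitely many seminorms, and each grows along `Π(z)ψ` at
most like some `e^{Mω(z)}`. -/
theorem exists_norm_stft_growth (ψ : SOmega ω d) (u : SOmegaDual ω d) :
    ∃ C M : ℝ, 0 ≤ C ∧ 0 ≤ M ∧ ∀ z, ‖stft ψ u z‖ ≤ C * Real.exp (M * ω ‖z‖) := by
  obtain ⟨s, K, -, hs⟩ := Seminorm.bound_of_continuous (withSeminorms ω d)
    ((normSeminorm ℂ ℂ).comp u.toLinearMap) (continuous_norm.comp u.continuous)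
  choose C M hC hM h using exists_seminorm_shift_le ψ
  have hA : 0 ≤ ∑ i ∈ s, C i := Finset.sum_nonneg fun i _ => hC i
  refine ⟨K * ∑ i ∈ s, C i, ∑ i ∈ s, M i, mul_nonneg K.2 hA,
    Finset.sum_nonneg fun i _ => hM i, fun z => (hs (conjFun (shift z ψ))).trans ?_⟩
  rw [mul_assoc]
  refine mul_le_mul_of_nonneg_left ?_ K.2
  refine Seminorm.finset_sup_apply_le (mul_nonneg hA (Real.exp_nonneg _)) fun i hi => ?_
  rw [seminormFamily_conjFun]
  refine (h i z).trans (mul_le_mul (Finset.single_le_sum (fun i _ => hC i) hi) ?_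
    (Real.exp_nonneg _) hA)
  exact Real.exp_le_exp.2 (mul_le_mul_of_nonneg_right
    (Finset.single_le_sum (fun i _ => hM i) hi) (ω.norm_nonneg z))

theorem norm_stft_dualShift (φ : SOmega ω d) (u : SOmegaDual ω d) (w z : PhaseSpace d) :
    ‖stft φ (dualShift w u) z‖ = ‖stft φ u (z - w)‖ := by
  -- Moving the operators onto the test function gives a shift by `z - w` up to a unimodular factor.
  have e : translate (-w.fst) (modulate w.snd (conjFun (shift z φ))) =
      character (w.snd - z.snd) w.fst • conjFun (shift (z - w) φ) := by
    refine SOmega.ext fun t => ?_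
    rw [SOmega.coe_smul, Pi.smul_apply, smul_eq_mul, translate_apply, modulate_apply,
      conjFun_apply, conjFun_apply, shift_apply', shift_apply', map_mul, map_mul, ← mul_assoc,
      ← mul_assoc]
    congr 1
    · unfold character
      rw [← Complex.exp_conj, ← Complex.exp_conj, ← Complex.exp_add, ← Complex.exp_add]
      congr 1
      simp only [map_mul, Complex.conj_I, Complex.conj_ofReal, sub_neg_eq_add, inner_add_left,
        inner_sub_right, WithLp.sub_snd]
      push_cast
      ring
    · congr 2
      rw [WithLp.sub_fst]
      abel
  change ‖u (translate (-w.fst) (modulate w.snd (conjFun (shift z φ))))‖ = _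
  rw [e, map_smul, norm_smul, norm_character, one_mul]
  rfl

/-- The convolution bound from the reproducing formula, in a form free of integrals: a pointwise
bound of the integrand by `B e^{-2(d+1)ω(w - z)}` suffices, because the integral of that exponential
is finite and independent of `z`. -/
theorem exists_norm_stft_le (φ : SOmega ω d) {ψ : SOmega ω d} (hψ : ψ ≠ 0) (u : SOmegaDual ω d)
    {μ : ℝ} (hμ : 0 < μ) : ∃ C : ℝ, 0 ≤ C ∧ ∀ (z : PhaseSpace d) (B : ℝ),
      (∀ w, Real.exp (-(μ * ω ‖w - z‖)) * ‖stft ψ u w‖ ≤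
        B * Real.exp (-(2 * (d + 1) * ω ‖w - z‖))) → ‖stft φ u z‖ ≤ C * B := by
  obtain ⟨A, hA, hA'⟩ := exists_coef_conj_shift_le φ ψ hμ
  let I := ∫ p : Euc d × Euc d, Real.exp (-(2 * (d + 1) * ω ‖toPhase p‖))
  have hI : 0 ≤ I := integral_nonneg fun p => Real.exp_nonneg _
  have hN : 0 < |reproConst ψ| := abs_pos.2 (reproConst_ne_zero hψ)
  refine ⟨|reproConst ψ|⁻¹ * (A * I), by positivity, fun z B hB => ?_⟩
  have h := congrArg norm (integral_coef_mul_stft u (conjFun (shift z φ)) ψ)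
  rw [norm_mul, Complex.norm_real, Real.norm_eq_abs] at h
  rw [mul_assoc, ← div_eq_inv_mul, le_div_iff₀ hN, mul_comm]
  refine h.symm.le.trans ?_
  refine (norm_integral_le_of_norm_le ((integrable_exp_weight_phase ω d z le_rfl).const_mul
    (A * B)) (Eventually.of_forall fun p => ?_)).trans (le_of_eq ?_)
  · rw [norm_mul]
    calc _ ≤ A * Real.exp (-(μ * ω ‖toPhase p - z‖)) * ‖stft ψ u (toPhase p)‖ := by
          gcongr
          exact hA' z _
      _ ≤ A * (B * Real.exp (-(2 * (d + 1) * ω ‖toPhase p - z‖))) := by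
          rw [mul_assoc]
          exact mul_le_mul_of_nonneg_left (hB _) hA
      _ = _ := by ring
  · rw [integral_const_mul, integral_exp_weight_phase]
    ring

theorem exists_norm_stft_sub_le (φ : SOmega ω d) {ψ : SOmega ω d} (hψ : ψ ≠ 0)
    (u : SOmegaDual ω d) (a b : PhaseSpace d) {μ : ℝ} (hμ : 0 < μ) :
    ∃ C : ℝ, 0 ≤ C ∧ ∀ (z : PhaseSpace d) (B : ℝ),
      (∀ w, Real.exp (-(μ * ω ‖w - z‖)) * ‖stft ψ u (w - b)‖ ≤
        B * Real.exp (-(2 * (d + 1) * ω ‖w - z‖))) → ‖stft φ u (z - a)‖ ≤ C * B := by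
  obtain ⟨C, hC, h⟩ := exists_norm_stft_le φ hψ u hμ
  -- Recentring from `z - a` to `z - b` changes both exponentials, of rates `μ` and `2 * (d + 1)`,
  -- by at most the rate times `ω(a - b)`.
  refine ⟨C * Real.exp ((μ + 2 * (d + 1)) * ω ‖a - b‖), by positivity, fun z B hB => ?_⟩
  rw [mul_assoc]
  refine h (z - a) _ fun w => ?_
  have hw := hB (w + b)
  rw [add_sub_cancel_right] at hw
  have hB0 : 0 ≤ B := nonneg_of_mul_nonneg_left (le_trans (by positivity) hw) (Real.exp_pos _)
  have e1 : ω ‖w + b - z‖ ≤ ω ‖w - (z - a)‖ + ω ‖a - b‖ := by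
    rw [show w + b - z = (w - (z - a)) - (a - b) by abel]
    exact ω.norm_sub_le _ _
  have e2 : ω ‖w - (z - a)‖ ≤ ω ‖w + b - z‖ + ω ‖a - b‖ := by
    rw [show w - (z - a) = (w + b - z) + (a - b) by abel]
    exact ω.norm_add_le _ _
  calc _ ≤ Real.exp (μ * ω ‖a - b‖) *
        (Real.exp (-(μ * ω ‖w + b - z‖)) * ‖stft ψ u w‖) := by
        rw [← mul_assoc, ← Real.exp_add]
        gcongr
        nlinarith
    _ ≤ Real.exp (μ * ω ‖a - b‖) * (B * Real.exp (-(2 * (d + 1) * ω ‖w + b - z‖))) := by gcongr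
    _ ≤ Real.exp (μ * ω ‖a - b‖) * (B * (Real.exp (2 * (d + 1) * ω ‖a - b‖) *
        Real.exp (-(2 * (d + 1) * ω ‖w - (z - a)‖)))) := by
        rw [← Real.exp_add (2 * (d + 1) * ω ‖a - b‖)]
        gcongr
        have : (0 : ℝ) ≤ 2 * (d + 1) := by positivity
        nlinarith
    _ = _ := by
        rw [add_mul, Real.exp_add]
        ring

/-- A point of an open cone has a smaller conic neighbourhood whose points `z` are separated from
the complement of the cone by a distance comparable to `‖z‖`. -/
theorem exists_separated_subcone {Γ : Set (PhaseSpace d)} (hΓ : IsOpen Γ) (hc : IsConic Γ)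
    (h0 : (0 : PhaseSpace d) ∉ Γ) {z₀ : PhaseSpace d} (hz₀ : z₀ ∈ Γ) :
    ∃ Γ' : Set (PhaseSpace d), IsOpen Γ' ∧ IsConic Γ' ∧ (0 : PhaseSpace d) ∉ Γ' ∧ z₀ ∈ Γ' ∧
      ∃ n : ℕ, ∀ z ∈ Γ', ∀ w ∉ Γ, ‖z‖ ≤ (n + 1) * ‖w - z‖ := by
  obtain ⟨r, hr, hball⟩ := Metric.isOpen_iff.1 hΓ z₀ hz₀
  -- The cone generated by the ball of half the radius of one contained in `Γ`.
  refine ⟨⋃ t ∈ Set.Ioi (0 : ℝ), (t • ·) '' Metric.ball z₀ (r / 2), ?_, ?_, ?_, ?_, ?_⟩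
  · exact isOpen_biUnion fun t ht =>
      (isOpenMap_smul₀ (ne_of_gt (Set.mem_Ioi.1 ht))) _ Metric.isOpen_ball
  · intro z hz s hs
    simp only [Set.mem_iUnion] at hz ⊢
    obtain ⟨t, ht, y, hy, rfl⟩ := hz
    exact ⟨s * t, mul_pos hs ht, y, hy, mul_smul _ _ _⟩
  · intro hz
    simp only [Set.mem_iUnion] at hz
    obtain ⟨t, ht, y, hy, e⟩ := hz
    refine h0 ?_
    rw [← e]
    exact hc y (hball (Metric.ball_subset_ball (by linarith) hy)) t ht
  · simp only [Set.mem_iUnion]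
    exact ⟨1, Set.mem_Ioi.2 one_pos, z₀, Metric.mem_ball_self (by positivity), one_smul _ _⟩
  · obtain ⟨n, hn⟩ := exists_nat_ge ((‖z₀‖ + r / 2) / (r / 2))
    refine ⟨n, fun z hz w hw => ?_⟩
    simp only [Set.mem_iUnion] at hz
    obtain ⟨t, ht, y, hy, rfl⟩ := hz
    have ht' : 0 < t := ht
    have h1 : r ≤ ‖t⁻¹ • w - z₀‖ := by
      by_contra! h
      refine hw ?_
      have := hc _ (hball (show t⁻¹ • w ∈ Metric.ball z₀ r by rwa [mem_ball_iff_norm])) t ht'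
      rwa [smul_inv_smul₀ ht'.ne'] at this
    rw [mem_ball_iff_norm] at hy
    have h2 : ‖t⁻¹ • w - z₀‖ ≤ ‖t⁻¹ • w - y‖ + ‖y - z₀‖ := norm_sub_le_norm_sub_add_norm_sub ..
    have h3 : ‖w - t • y‖ = t * ‖t⁻¹ • w - y‖ := by
      rw [← norm_smul_of_nonneg ht'.le, smul_sub, smul_inv_smul₀ ht'.ne']
    have h4 : ‖y‖ ≤ ‖z₀‖ + ‖y - z₀‖ := by
      simpa using norm_add_le z₀ (y - z₀)
    rw [div_le_iff₀ (by positivity)] at hn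
    change ‖t • y‖ ≤ (n + 1) * ‖w - t • y‖
    rw [h3, norm_smul_of_nonneg ht'.le, mul_left_comm]
    refine mul_le_mul_of_nonneg_left ?_ ht'.le
    have h5 : r / 2 ≤ ‖t⁻¹ • w - y‖ := by linarith
    calc ‖y‖ ≤ n * (r / 2) := by linarith
      _ ≤ (n + 1) * ‖t⁻¹ • w - y‖ := by gcongr; linarith

/-- Rapid decay of `G` in an open cone passes to `F` in a smaller cone, if `F` is dominated by
convolutions of `G` with rapidly decreasing kernels and `G` has moderate growth. -/
theorem exists_cone_decay {F G : PhaseSpace d → ℝ}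
    (hdom : ∀ μ : ℝ, 0 < μ → ∃ C : ℝ, 0 ≤ C ∧ ∀ (z : PhaseSpace d) (B : ℝ),
      (∀ w, Real.exp (-(μ * ω ‖w - z‖)) * G w ≤
        B * Real.exp (-(2 * (d + 1) * ω ‖w - z‖))) → F z ≤ C * B)
    (hgrow : ∃ C M : ℝ, 0 ≤ C ∧ 0 ≤ M ∧ ∀ z, G z ≤ C * Real.exp (M * ω ‖z‖))
    {z₀ : PhaseSpace d}
    (h : ∃ Γ : Set (PhaseSpace d), IsOpen Γ ∧ IsConic Γ ∧ (0 : PhaseSpace d) ∉ Γ ∧ z₀ ∈ Γ ∧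
      ∀ μ : ℝ, 0 < μ → BddAbove ((fun z => Real.exp (μ * ω ‖z‖) * G z) '' Γ)) :
    ∃ Γ : Set (PhaseSpace d), IsOpen Γ ∧ IsConic Γ ∧ (0 : PhaseSpace d) ∉ Γ ∧ z₀ ∈ Γ ∧
      ∀ μ : ℝ, 0 < μ → BddAbove ((fun z => Real.exp (μ * ω ‖z‖) * F z) '' Γ) := by
  obtain ⟨Γ, hΓ, hc, h0, hz₀, hdecay⟩ := h
  obtain ⟨Γ', hΓ', hc', h0', hz₀', n, hn⟩ := exists_separated_subcone hΓ hc h0 hz₀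
  refine ⟨Γ', hΓ', hc', h0', hz₀', fun μ hμ => ?_⟩
  obtain ⟨A, M, hA, hM, hgrow⟩ := hgrow
  obtain ⟨K, hK⟩ := hdecay μ hμ
  -- The rate serves both cases. Inside `Γ`, `μ` pays for passing from `ω(w)` to `ω(z)`. Outside,
  -- `M` pays for passing from `ω(w)` to `ω(z)` in the growth bound, and `(μ + M)(n + 1)` then
  -- dominates `(μ + M) ω(z)`. The term `2 * (d + 1)` is left for integrability.
  obtain ⟨C, hC, hF⟩ := hdom (μ + (μ + M) * (n + 1) + M + 2 * (d + 1)) (by positivity)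
  refine ⟨C * (|K| + A), ?_⟩
  rintro _ ⟨z, hz, rfl⟩
  have key : F z ≤ C * ((|K| + A) * Real.exp (-(μ * ω ‖z‖))) := by
    refine hF z _ fun w => ?_
    have ha := ω.norm_nonneg (w - z)
    have hna : 0 ≤ (μ + M) * (n + 1) * ω ‖w - z‖ := by positivity
    by_cases hw : w ∈ Γ
    · have h1 : G w ≤ |K| * Real.exp (-(μ * ω ‖w‖)) := by
        rw [Real.exp_neg, ← div_eq_mul_inv, le_div_iff₀ (Real.exp_pos _), mul_comm]
        exact (hK ⟨w, hw, rfl⟩).trans (le_abs_self K)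
      have h2 : ω ‖z‖ ≤ ω ‖w‖ + ω ‖w - z‖ := by
        simpa using ω.norm_sub_le w (w - z)
      refine (mul_le_mul_of_nonneg_left h1 (Real.exp_nonneg _)).trans ?_
      rw [mul_left_comm, ← Real.exp_add, mul_assoc, ← Real.exp_add]
      refine mul_le_mul (le_add_of_nonneg_right hA) (Real.exp_le_exp.2 ?_) (Real.exp_nonneg _)
        (by positivity)
      nlinarith [mul_nonneg hM ha, mul_le_mul_of_nonneg_left h2 hμ.le]
    · have h1 := hgrow w
      have h2 : ω ‖w‖ ≤ ω ‖z‖ + ω ‖w - z‖ := by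
        simpa using ω.norm_add_le z (w - z)
      have h3 : ω ‖z‖ ≤ (n + 1) * ω ‖w - z‖ :=
        (ω.mono (norm_nonneg _) (hn z hz w hw)).trans (ω.nat_succ_mul_le n (norm_nonneg _))
      refine (mul_le_mul_of_nonneg_left h1 (Real.exp_nonneg _)).trans ?_
      rw [mul_left_comm, ← Real.exp_add, mul_assoc, ← Real.exp_add]
      refine mul_le_mul (le_add_of_nonneg_left (abs_nonneg K)) (Real.exp_le_exp.2 ?_)
        (Real.exp_nonneg _) (by positivity)
      nlinarith [mul_nonneg hμ.le ha, mul_le_mul_of_nonneg_left h2 hM,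
        mul_le_mul_of_nonneg_left h3 (add_nonneg hμ.le hM)]
  calc _ ≤ Real.exp (μ * ω ‖z‖) * (C * ((|K| + A) * Real.exp (-(μ * ω ‖z‖)))) :=
        mul_le_mul_of_nonneg_left key (Real.exp_nonneg _)
    _ = C * (|K| + A) := by
        rw [Real.exp_neg]
        field_simp

end WindowChange

end GaborWF

end

theorem mainTheorem4 (ω : GaborWF.Weight) (d : ℕ) (φ ψ : GaborWF.SOmega ω d)
    (hφ : φ ≠ 0) (hψ : ψ ≠ 0) (w : GaborWF.PhaseSpace d) (u : GaborWF.SOmegaDual ω d) :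
    GaborWF.waveFrontSet φ (GaborWF.dualShift w u) = GaborWF.waveFrontSet ψ u := by
  ext z₀
  refine and_congr_right fun _ => not_congr
    ⟨GaborWF.exists_cone_decay (fun μ hμ => ?_) (GaborWF.exists_norm_stft_growth φ _),
      GaborWF.exists_cone_decay (fun μ hμ => ?_) (GaborWF.exists_norm_stft_growth ψ u)⟩
  -- The two inclusions use the same estimate with the translation by `w` on the dominating side
  -- here, and on the dominated side in the other case.
  · obtain ⟨C, hC, h⟩ := GaborWF.exists_norm_stft_sub_le ψ hφ u 0 w hμ
    refine ⟨C, hC, fun z B hB => ?_⟩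
    rw [← sub_zero z]
    exact h z B fun v => by simpa only [GaborWF.norm_stft_dualShift] using hB v
  · obtain ⟨C, hC, h⟩ := GaborWF.exists_norm_stft_sub_le φ hψ u w 0 hμ
    refine ⟨C, hC, fun z B hB => ?_⟩
    rw [GaborWF.norm_stft_dualShift]
    exact h z B fun v => by simpa only [sub_zero] using hB v
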